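/- **Setting.** An instance is $(G,k,(s_i,t_i)_{i\in[3]},V^\infty)$: a finite directed graph $G$, terminals $s_1,s_2,s_3,t_1,t_2,t_3$, an integer $k\ge 0$, and a set $V^\infty\subseteq V(G)$ of undeletable vertices that contains all terminals. A *solution* is a set $S\subseteq V(G)\setminus V^\infty$ with $|S|\le k$ such that $t_i$ is not reachable from $s_i$ in $G-S$ for $i=1,2,3$. It is *shadowless* if every non-terminal vertex $v\notin S$ is, in $G-S$, reachable from some $s_j$ and reaches some $t_{j'}$. An $s_it_i$-*flow* is a collection of $s_it_i$-paths no two of which share a vertex outside $V^\infty$; its value is the number of paths, or $\infty$ if one of the paths lies in $V^\infty$; a *maxflow* is a flow of maximum value. A *$CD$-soybean* in $G$ is a pair of walks of $G$ with the same first vertex and the same last vertex, one of which meets $C$ and the other $D$. Two sets $C,D$ are *interlaced* on a path if for some $m$ they are $\{c_1,\dots,c_m\}$ and $\{d_1,\dots,d_m\}$, appearing along the path in the order $c_1,d_1,c_2,d_2,\dots,c_m,d_m$. For functions $c:\mathbb N\to\mathbb N$ and $q:\mathbb N\times\mathbb N\to\mathbb N$, an *augmentation* for the pair $(s_i,t_i)$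 consists of a set $A_i\subseteq V(G)\times V(G)$ of arcs, an $s_it_i$-maxflow $\mathcal P_i$ in $G+A_i$, and a partition $\mathcal B_i$ of the vertices outside $V^\infty$ on the paths of $\mathcal P_i$ into at most $c(k)$ parts, such that for every $P\in\mathcal P_i$, every $p\in\mathbb N$, every $B\in\mathcal B_i$ and all disjoint $C,D\subseteq B\cap V(P)$ of size at least $q(k,p)$ that are interlaced on $P$, the graph $G$ contains $p$ pairwise vertex-disjoint $CD$-soybeans. (Flow augmentation produces such triples for suitable computable $c,q$.) The *grid rank* of a 0-1 matrix is the largest $r$ such that its rows and its columns can each be divided into $r$ nonempty intervals so that each of the $r^2$ cells has at least $r$ distinct rows and at least $r$ distinct columns (and $0$ if there is no such $r$). For paths $P\in\mathcal P_i$ and $P'\in\mathcal P_{i'}$ with domains $D\subseteq V(P)\setminus V^\infty$ and $D'\subseteq V(P')\setminus V^\infty$, the *consistency constraint* $\pi$ is the permutation constraint $u\mapsto u$ on $D\cap D'$. The rows of its matrix $\mathrm{Adj}(\pi)$ are the elements of $D$ in the order along $P$, the columns are the elements of $D'$ in the order along $P'$, and an entry is $1$ iff its row and its column are the same vertex. **Lemma.**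 Let $c$ and $q$ be computable functions. There are computable functions $h,f:\mathbb N\to\mathbb N$, a constant $e$ and an algorithm with the following property. Let $(G,k,(s_i,t_i)_{i\in[3]},V^\infty)$ be an instance, let $i\ne i'$ be in $[3]$, let $(A_i,\mathcal P_i,\mathcal B_i)$ and $(A_{i'},\mathcal P_{i'},\mathcal B_{i'})$ be augmentations for $(s_i,t_i)$ and $(s_{i'},t_{i'})$, and let $P\in\mathcal P_i$, $P'\in\mathcal P_{i'}$ and $\pi$, with domains $D$ and $D'$, be as above. Given the instance, the indices $i,i'$, the paths $P,P'$, the partitions $\mathcal B_i,\mathcal B_{i'}$ and the constraint $\pi$ with its domains, the algorithm stops after at most $f(k)\cdot N^e$ steps, where $N$ is the length of its input (which is at least the number of vertices), and either * correctly reports that the grid rank of $\mathrm{Adj}(\pi)$ is at most $h(k)$, or * outputs a vertex $v\in D\cap D'$ such that there is no shadowless solution $S$ with $v\in S$ for which, in $G-S$, * no vertex before $v$ on $P$ reaches $t_i$ and no vertex after $v$ on $P$ is reachable from $s_i$, and * no vertex before $v$ on $P'$ reaches $t_{i'}$ and no vertex after $v$ on $P'$ is reachable from $s_{i'}$. -/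

import Mathlib

/-! ### Random access machines

A structured program over natural-number registers and a memory indexed by natural numbers.
Arithmetic is limited to addition and truncated subtraction, and every operation is charged, so
that running times agree with those of Turing machines up to a polynomial. -/

namespace RAM

/-- A machine state: the contents of the registers and of the memory cells. -/
structure State where
  reg : ℕ → ℕ
  mem : ℕ → ℕ

/-- Expressions over registers and memory. -/
inductive Expr where
  | lit (c : ℕ)
  | reg (r : ℕ)
  | mem (e : Expr)
  | add (e₁ e₂ : Expr)
  | sub (e₁ e₂ : Expr)

/-- The value of an expression. -/
def Expr.eval (σ : State) : Expr → ℕ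
  | .lit c => c
  | .reg r => σ.reg r
  | .mem e => σ.mem (e.eval σ)
  | .add e₁ e₂ => e₁.eval σ + e₂.eval σ
  | .sub e₁ e₂ => e₁.eval σ - e₂.eval σ

/-- The cost of evaluating an expression: one unit for each of its nodes. -/
def Expr.cost : Expr → ℕ
  | .lit _ => 1
  | .reg _ => 1
  | .mem e => e.cost + 1
  | .add e₁ e₂ => e₁.cost + e₂.cost + 1
  | .sub e₁ e₂ => e₁.cost + e₂.cost + 1

/-- Programs: assignment to a register, writing to memory, sequencing, branching and looping
(a condition holds when its value is nonzero). -/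
inductive Prog where
  | set (r : ℕ) (e : Expr)
  | store (addr val : Expr)
  | seq (p₁ p₂ : Prog)
  | ite (e : Expr) (p₁ p₂ : Prog)
  | loop (e : Expr) (p : Prog)

/-- `Exec p σ t σ'`: started in state `σ`, the program `p` halts in state `σ'` after `t` steps. -/
inductive Exec : Prog → State → ℕ → State → Prop where
  | set (r : ℕ) (e : Expr) (σ : State) :
      Exec (.set r e) σ (e.cost + 1) ⟨Function.update σ.reg r (e.eval σ), σ.mem⟩
  | store (a e : Expr) (σ : State) :
      Exec (.store a e) σ (a.cost + e.cost + 1)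
        ⟨σ.reg, Function.update σ.mem (a.eval σ) (e.eval σ)⟩
  | seq {p₁ p₂ : Prog} {σ σ' σ'' : State} {t₁ t₂ : ℕ}
      (h₁ : Exec p₁ σ t₁ σ') (h₂ : Exec p₂ σ' t₂ σ'') : Exec (.seq p₁ p₂) σ (t₁ + t₂) σ''
  | ite_true {e : Expr} {p₁ p₂ : Prog} {σ σ' : State} {t : ℕ} (he : e.eval σ ≠ 0)
      (h : Exec p₁ σ t σ') : Exec (.ite e p₁ p₂) σ (e.cost + 1 + t) σ'
  | ite_false {e : Expr} {p₁ p₂ : Prog} {σ σ' : State} {t : ℕ} (he : e.eval σ = 0)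
      (h : Exec p₂ σ t σ') : Exec (.ite e p₁ p₂) σ (e.cost + 1 + t) σ'
  | loop_stop {e : Expr} {p : Prog} {σ : State} (he : e.eval σ = 0) :
      Exec (.loop e p) σ (e.cost + 1) σ
  | loop_step {e : Expr} {p : Prog} {σ σ' σ'' : State} {t₁ t₂ : ℕ} (he : e.eval σ ≠ 0)
      (h₁ : Exec p σ t₁ σ') (h₂ : Exec (.loop e p) σ' t₂ σ'') :
      Exec (.loop e p) σ (e.cost + 1 + t₁ + t₂) σ''

/-- The initial state on a list of input words: the words are in the memory cells `0, 1, 2, …`,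
register `0` holds their number, and everything else is `0`. -/
def initState (w : List ℕ) : State where
  reg := fun r => if r = 0 then w.length else 0
  mem := fun a => w.getD a 0

/-- On input `w` the program halts within `T` steps with `out` in register `0`. -/
def OutputsWithin (p : Prog) (w : List ℕ) (out T : ℕ) : Prop :=
  ∃ t σ, Exec p (initState w) t σ ∧ t ≤ T ∧ σ.reg 0 = out

end RAM

/-! ### Grid rank of 0-1 matrices -/

/-- `cut 0 = 0 < cut 1 < ⋯ < cut r = m` describes a partition of `{0, …, m - 1}` into `r`
nonempty intervals. -/
def IsIntervalDivision (m r : ℕ) (cut : Fin (r + 1) → ℕ) : Prop :=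
  StrictMono cut ∧ cut 0 = 0 ∧ cut (Fin.last r) = m

/-- The `a`-th interval of a division. -/
def divisionPart (m : ℕ) {r : ℕ} (cut : Fin (r + 1) → ℕ) (a : Fin r) : Finset (Fin m) :=
  Finset.univ.filter fun x => cut a.castSucc ≤ x.val ∧ x.val < cut a.succ

/-- The number of distinct rows of the submatrix with row set `R` and column set `C`. -/
def distinctRows {m m' : ℕ} (M : Matrix (Fin m) (Fin m') Bool) (R : Finset (Fin m))
    (C : Finset (Fin m')) : ℕ :=
  (R.image fun x => fun y : {y // y ∈ C} => M x y).card

/-- `M` admits a rank-`r` division: an `r`-division each of whose cells has at least `r` distinct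
rows and at least `r` distinct columns. -/
def HasRankDivision {m m' : ℕ} (M : Matrix (Fin m) (Fin m') Bool) (r : ℕ) : Prop :=
  ∃ cutR cutC : Fin (r + 1) → ℕ,
    IsIntervalDivision m r cutR ∧ IsIntervalDivision m' r cutC ∧
    ∀ a b : Fin r,
      r ≤ distinctRows M (divisionPart m cutR a) (divisionPart m' cutC b) ∧
      r ≤ distinctRows M.transpose (divisionPart m' cutC b) (divisionPart m cutR a)

/-- The grid rank: the largest `r` such that `M` admits a rank-`r` division. -/
noncomputable def gridRank {m m' : ℕ} (M : Matrix (Fin m) (Fin m') Bool) : ℕ :=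
  sSup {r | HasRankDivision M r}

/-- The number of rows bounds the size of every rank division, so the supremum that defines the
grid rank is one of a bounded set. -/
theorem HasRankDivision.le_rows {m m' : ℕ} {M : Matrix (Fin m) (Fin m') Bool} {r : ℕ}
    (h : HasRankDivision M r) : r ≤ m := by
  obtain ⟨cutR, cutC, -, -, hc⟩ := h
  rcases Nat.eq_zero_or_pos r with rfl | hr
  · exact Nat.zero_le m
  · refine (hc ⟨0, hr⟩ ⟨0, hr⟩).1.trans (Finset.card_image_le.trans ?_)
    exact (Finset.card_le_univ _).trans (by simp)

/-! ### Walks and paths in directed graphs, soybeans -/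

/-- `l` is the vertex sequence of a walk from `u` to `v` in `G`. -/
def IsDiWalk {V : Type} (G : Digraph V) (u v : V) (l : List V) : Prop :=
  l.head? = some u ∧ l.getLast? = some v ∧ l.IsChain G.Adj

/-- `l` is the vertex sequence of a path from `u` to `v` in `G`. -/
def IsDiPath {V : Type} (G : Digraph V) (u v : V) (l : List V) : Prop :=
  IsDiWalk G u v l ∧ l.Nodup

/-- There is a path from `u` to `v` in `G - S`. -/
def ReachesAvoiding {V : Type} (G : Digraph V) (S : Finset V) (u v : V) : Prop :=
  u ∉ S ∧ Relation.ReflTransGen (fun a b => G.Adj a b ∧ b ∉ S) u v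

/-- The graph `G + A`. -/
def addArcs {V : Type} (G : Digraph V) (A : Finset (V × V)) : Digraph V where
  Adj u v := G.Adj u v ∨ (u, v) ∈ A

/-- `C = {c₁, …, c_m}` and `D = {d₁, …, d_m}` occur on the path `P` in the order
`c₁, d₁, c₂, d₂, …, c_m, d_m`. -/
def Interlaced {V : Type} [DecidableEq V] (P : List V) (C D : Finset V) : Prop :=
  ∃ (m : ℕ) (c d : Fin m → V),
    C = Finset.univ.image c ∧ D = Finset.univ.image d ∧
    (∀ i, c i ∈ P ∧ d i ∈ P) ∧
    (∀ i, P.idxOf (c i) < P.idxOf (d i)) ∧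
    ∀ i j, i < j → P.idxOf (d i) < P.idxOf (c j)

/-- The pair of walks `Q, Q'` is a `CD`-soybean in `G`: both walks have the same first vertex and
the same last vertex, one of them meets `C` and the other one meets `D`. -/
def IsSoybean {V : Type} (G : Digraph V) (C D : Finset V) (Q Q' : List V) : Prop :=
  (∃ a b, IsDiWalk G a b Q ∧ IsDiWalk G a b Q') ∧
    (((∃ x ∈ Q, x ∈ C) ∧ ∃ y ∈ Q', y ∈ D) ∨ ((∃ x ∈ Q', x ∈ C) ∧ ∃ y ∈ Q, y ∈ D))

/-- `G` contains `p` pairwise vertex-disjoint `CD`-soybeans. -/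
def HasDisjointSoybeans {V : Type} (G : Digraph V) (C D : Finset V) (p : ℕ) : Prop :=
  ∃ Q Q' : Fin p → List V,
    (∀ a, IsSoybean G C D (Q a) (Q' a)) ∧
    ∀ a b, a ≠ b → ∀ x, (x ∈ Q a ∨ x ∈ Q' a) → ¬ (x ∈ Q b ∨ x ∈ Q' b)

/-! ### Directed multicut with three terminal pairs -/

/-- An instance of directed multicut with three terminal pairs on the vertex set
`{0, …, n - 1}`. -/
structure MulticutInstance (n : ℕ) where
  /-- the directed graph -/
  G : Digraph (Fin n)
  /-- the bound on the size of a solution -/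
  k : ℕ
  /-- the sources -/
  s : Fin 3 → Fin n
  /-- the sinks -/
  t : Fin 3 → Fin n
  /-- the undeletable vertices -/
  undel : Finset (Fin n)
  /-- terminals are undeletable -/
  s_mem : ∀ i, s i ∈ undel
  t_mem : ∀ i, t i ∈ undel

namespace MulticutInstance

variable {n : ℕ}

/-- `v` is one of the six terminals. -/
def IsTerminal (I : MulticutInstance n) (v : Fin n) : Prop :=
  (∃ i, v = I.s i) ∨ ∃ i, v = I.t i

/-- `S` is a solution of the instance: at most `k` deletable vertices that cut every `t i` off
from `s i`. -/
def IsSolution (I : MulticutInstance n) (S : Finset (Fin n)) : Prop :=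
  S.card ≤ I.k ∧ Disjoint S I.undel ∧ ∀ i, ¬ ReachesAvoiding I.G S (I.s i) (I.t i)

/-- `S` is shadowless: in `G - S` each non-terminal vertex is reachable from some `s j` and
reaches some `t j`. -/
def IsShadowless (I : MulticutInstance n) (S : Finset (Fin n)) : Prop :=
  ∀ v, v ∉ S → ¬ I.IsTerminal v →
    (∃ j, ReachesAvoiding I.G S (I.s j) v) ∧ ∃ j, ReachesAvoiding I.G S v (I.t j)

/-- In `G - S`, the vertices before `v` on `P` do not reach `t i` and the vertices after `v` on
`P` are not reachable from `s i`. -/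
def SplitsAt (I : MulticutInstance n) (S : Finset (Fin n)) (i : Fin 3) (P : List (Fin n))
    (v : Fin n) : Prop :=
  (∀ u ∈ P, P.idxOf u < P.idxOf v → ¬ ReachesAvoiding I.G S u (I.t i)) ∧
    ∀ u ∈ P, P.idxOf v < P.idxOf u → ¬ ReachesAvoiding I.G S (I.s i) u

/-! ### Flows and augmentations -/

/-- `F` is a flow from `s i` to `t i` in the graph `H`: a collection of paths that share no
deletable vertex. -/
def IsFlow (I : MulticutInstance n) (H : Digraph (Fin n)) (i : Fin 3)
    (F : Finset (List (Fin n))) : Prop :=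
  (∀ P ∈ F, IsDiPath H (I.s i) (I.t i) P) ∧
    ∀ P ∈ F, ∀ Q ∈ F, P ≠ Q → ∀ x, x ∈ P → x ∈ Q → x ∈ I.undel

open Classical in
/-- The value of a flow: the number of its paths, or `∞` if one of them consists of undeletable
vertices only. -/
noncomputable def flowValue (I : MulticutInstance n) (F : Finset (List (Fin n))) : ℕ∞ :=
  if ∃ P ∈ F, ∀ x ∈ P, x ∈ I.undel then ⊤ else (F.card : ℕ∞)

/-- `F` is a maximum flow from `s i` to `t i` in the graph `H`. -/
def IsMaxflow (I : MulticutInstance n) (H : Digraph (Fin n)) (i : Fin 3)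
    (F : Finset (List (Fin n))) : Prop :=
  I.IsFlow H i F ∧ ∀ F', I.IsFlow H i F' → I.flowValue F' ≤ I.flowValue F

/-- The deletable vertices on the paths of `F`. -/
def flowVertices (I : MulticutInstance n) (F : Finset (List (Fin n))) : Finset (Fin n) :=
  F.biUnion List.toFinset \ I.undel

/-- `(A, F, B)` has the properties of an output of flow augmentation for the pair `(s i, t i)`
with bounds `c` and `q`: `F` is a maximum flow in `G + A`, the partition `B` of the deletable
vertices on `F` has at most `c k` parts, and any two disjoint sets of at least `q k p` vertices
of one part that are interlaced on a path of `F` are linked by `p` vertex-disjoint soybeans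
of `G`. -/
structure IsAugmentation (I : MulticutInstance n) (c : ℕ → ℕ) (q : ℕ → ℕ → ℕ) (i : Fin 3)
    (A : Finset (Fin n × Fin n)) (F : Finset (List (Fin n)))
    (B : Finpartition (I.flowVertices F)) : Prop where
  maxflow : I.IsMaxflow (addArcs I.G A) i F
  card_parts : B.parts.card ≤ c I.k
  soybeans : ∀ P ∈ F, ∀ p : ℕ, ∀ b ∈ B.parts, ∀ C D : Finset (Fin n),
    C ⊆ b ∩ P.toFinset → D ⊆ b ∩ P.toFinset → Disjoint C D →
    q I.k p ≤ C.card → q I.k p ≤ D.card → Interlaced P C D →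
    HasDisjointSoybeans I.G C D p

end MulticutInstance

/-! ### Consistency constraints -/

/-- The domain `D` of the variable of the path `P`, listed in the order along `P`. -/
def orderedDomain {n : ℕ} (P : List (Fin n)) (D : Finset (Fin n)) : List (Fin n) :=
  P.filter (· ∈ D)

/-- The 0-1 matrix of the consistency constraint between the variables of the paths `P` and `P'`
with domains `D` and `D'`: this is the permutation constraint `u ↦ u` on `D ∩ D'`, the rows are
the elements of `D` in the order along `P`, the columns are the elements of `D'` in the order
along `P'`. -/
def consistencyMatrix {n : ℕ} (P P' : List (Fin n)) (D D' : Finset (Fin n)) :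
    Matrix (Fin (orderedDomain P D).length) (Fin (orderedDomain P' D').length) Bool :=
  Matrix.of fun x y => decide ((orderedDomain P D).get x = (orderedDomain P' D').get y)

/-! ### Encoding of the input as a list of words -/

open Classical in
/-- The truth value of a proposition as a word. -/
noncomputable def truthWord (p : Prop) : ℕ := if p then 1 else 0

/-- A vertex set as its list of indicators. -/
noncomputable def setWords {n : ℕ} (X : Finset (Fin n)) : List ℕ :=
  (List.finRange n).map fun v => truthWord (v ∈ X)

/-- A binary relation on the vertices as its table of indicators. -/
noncomputable def relWords {n : ℕ} (R : Fin n → Fin n → Prop) : List ℕ :=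
  (List.finRange n).flatMap fun u => (List.finRange n).map fun v => truthWord (R u v)

/-- A vertex sequence as its length followed by its members. -/
def pathWords {n : ℕ} (P : List (Fin n)) : List ℕ :=
  P.length :: P.map Fin.val

/-- A family of vertex sets as the table of the relation of lying in a common member. -/
noncomputable def partitionWords {n : ℕ} (B : Finset (Finset (Fin n))) : List ℕ :=
  relWords fun u v => ∃ b ∈ B, u ∈ b ∧ v ∈ b

/-- The input of the irrelevant-vertex rule: the instance, the indices of the two terminal pairs,
the two partitions, the two domains and the two paths. -/
noncomputable def inputWords {n : ℕ} (I : MulticutInstance n) (i i' : Fin 3)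
    (B B' : Finset (Finset (Fin n))) (D D' : Finset (Fin n)) (P P' : List (Fin n)) : List ℕ :=
  [n, I.k, I.s 0, I.s 1, I.s 2, I.t 0, I.t 1, I.t 2, i, i'] ++ setWords I.undel ++
    relWords I.G.Adj ++ partitionWords B ++ partitionWords B' ++ setWords D ++ setWords D' ++
    pathWords P ++ pathWords P'

/-!
Fix the two terminal pairs `i, i'`, let `j` be the third one, and compare vertices by their
positions on `P` and on `P'`. Let `S` be a shadowless solution that splits both paths at `v`. A
common vertex after `v` on both paths is not reachable from `s i` or `s i'` in `G - S`, hence only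
from `s j`; one before `v` on both paths reaches only `t j`. A *mixed* vertex, after `v` on `P` and
before `v` on `P'`, is not reachable from `s j` or does not reach `t j`, since `S` separates `s j`
from `t j`. If `q k (k + 7)` vertices of the first kind are interlaced on `P` with mixed vertices
that `s j` does not reach, all in one part of the partition, then one of `k + 7` disjoint soybeans
avoids `S` and the six terminals, and a source that reaches its first vertex reaches a vertex of
either set, which is impossible. The symmetric statement holds on `P'`, for vertices before `v` and
mixed vertices that do not reach `t j`.

The vertices after `v` on both paths cut `P` into gaps, those before `v` on both paths cut `P'` into
gaps, and the mixed vertices are the edges of a bipartite graph between the two families of gaps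
(`GapEdge`). A solution as above gives a vertex cover of this graph with fewer than `q k (k + 7)`
vertices on either side. So `v` may be output as soon as the graph has no such cover
(`MulticutInstance.not_exists_solution_of_coverIsLarge`). Conversely, in a division of large rank
every cell contains a common vertex; colouring it by its parts and passing to a monochromatic grid
(`exists_monochromatic_grid`), the middle vertex of the grid has a large matching in its gap graph
(`MulticutInstance.exists_coverIsLarge_of_lt_gridRank`).

To tell the two situations apart, the degrees of the gap graph are counted as in Buss's kernel for
vertex cover (`CoverIsLarge`). This needs only counting over first-order properties of the input,
so the algorithm is a term of a small counting language (`RAM.CTerm`), which is compiled to a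
polynomial-time program once and for all (`RAM.CTerm.runs_compile`). Its threshold
`q k (k + 7)` is computed by a program for an arbitrary computable function, with a computable time
bound (`RAM.exists_prog_of_computable`).
-/

/-! ### Timed Hoare triples for random access machines -/

namespace RAM

theorem update_of_lt {f : ℕ → ℕ} {b r x : ℕ} (h : r < b) : Function.update f b x r = f r :=
  Function.update_of_ne (by omega) _ _

/-- Started in `σ`, the program `p` halts within `T` steps in a state that satisfies `Q`. -/
def Runs (p : Prog) (σ : State) (T : ℕ) (Q : State → Prop) : Prop :=
  ∃ t σ', Exec p σ t σ' ∧ t ≤ T ∧ Q σ'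

theorem Runs.mono {p : Prog} {σ : State} {T T' : ℕ} {Q Q' : State → Prop} (h : Runs p σ T Q)
    (hT : T ≤ T') (hQ : ∀ σ', Q σ' → Q' σ') : Runs p σ T' Q' := by
  obtain ⟨t, σ', he, ht, hq⟩ := h
  exact ⟨t, σ', he, ht.trans hT, hQ _ hq⟩

theorem Runs.seq {p p' : Prog} {σ : State} {T T' : ℕ} {Q R : State → Prop}
    (h : Runs p σ T Q) (h' : ∀ σ', Q σ' → Runs p' σ' T' R) :
    Runs (.seq p p') σ (T + T') R := by
  obtain ⟨t, σ', he, ht, hq⟩ := h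
  obtain ⟨t', σ'', he', ht', hr⟩ := h' σ' hq
  exact ⟨t + t', σ'', .seq he he', by omega, hr⟩

theorem Runs.set {r : ℕ} {e : Expr} {σ : State} {Q : State → Prop}
    (h : Q ⟨Function.update σ.reg r (e.eval σ), σ.mem⟩) : Runs (.set r e) σ (e.cost + 1) Q :=
  ⟨_, _, .set r e σ, le_rfl, h⟩

theorem Runs.seq_set {r : ℕ} {e : Expr} {p : Prog} {σ : State} {T : ℕ} {Q : State → Prop}
    (h : Runs p ⟨Function.update σ.reg r (e.eval σ), σ.mem⟩ T Q) :
    Runs (.seq (.set r e) p) σ (e.cost + 1 + T) Q :=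
  (Runs.set (Q := (· = _)) rfl).seq fun _ hσ => hσ ▸ h

theorem Runs.ite {e : Expr} {p p' : Prog} {σ : State} {T T' : ℕ} {Q : State → Prop}
    (h : e.eval σ ≠ 0 → Runs p σ T Q) (h' : e.eval σ = 0 → Runs p' σ T' Q) :
    Runs (.ite e p p') σ (e.cost + 1 + (T + T')) Q := by
  by_cases he : e.eval σ = 0
  · obtain ⟨t, σ', hx, ht, hq⟩ := h' he
    exact ⟨_, σ', .ite_false he hx, by omega, hq⟩
  · obtain ⟨t, σ', hx, ht, hq⟩ := h he
    exact ⟨_, σ', .ite_true he hx, by omega, hq⟩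

/-- A loop that makes exactly `N` rounds, with the invariant `Inv i` before round `i`. -/
theorem Runs.loop {e : Expr} {p : Prog} (Inv : ℕ → State → Prop) (N : ℕ) (T : ℕ → ℕ)
    (hstep : ∀ i < N, ∀ σ, Inv i σ → e.eval σ ≠ 0 ∧ Runs p σ (T i) (Inv (i + 1)))
    (hfin : ∀ σ, Inv N σ → e.eval σ = 0) {σ : State} (h0 : Inv 0 σ) :
    Runs (.loop e p) σ ((∑ i ∈ Finset.range N, (T i + e.cost + 1)) + e.cost + 1) (Inv N) := by
  have key : ∀ d i, i + d = N → ∀ σ, Inv i σ →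
      Runs (.loop e p) σ ((∑ j ∈ Finset.range d, (T (i + j) + e.cost + 1)) + e.cost + 1)
        (Inv N) := by
    intro d
    induction d with
    | zero =>
      intro i hi σ hσ
      obtain rfl : i = N := by omega
      exact ⟨_, σ, Exec.loop_stop (hfin σ hσ), by simp, hσ⟩
    | succ d ih =>
      intro i hi σ hσ
      obtain ⟨he, t, σ', hx, ht, hq⟩ := hstep i (by omega) σ hσ
      obtain ⟨t', σ'', hx', ht', hq'⟩ := ih (i + 1) (by omega) σ' hq
      refine ⟨_, σ'', .loop_step he hx hx', ?_, hq'⟩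
      rw [Finset.sum_range_succ']
      simp only [show ∀ j, i + 1 + j = i + (j + 1) from fun j => by omega] at ht'
      simp only [Nat.add_zero]
      omega
  simpa using key N 0 (by omega) σ h0

/-! ### Counting terms and their compilation -/

/-- Terms over registers and memory with one binder, the sum over all values of a register below
the input length. Existential quantifiers are sums, so counting over first-order formulas
about the input can be expressed. -/
inductive CTerm where
  | lit (c : ℕ)
  | reg (r : ℕ)
  | mem (t : CTerm)
  | add (a b : CTerm)
  | sub (a b : CTerm)
  | ite (c a b : CTerm)
  | sum (r : ℕ) (t : CTerm)

namespace CTerm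

/-- The value of a term, where sums range over the numbers below `N`. -/
def eval (N : ℕ) (mem : ℕ → ℕ) : CTerm → (ℕ → ℕ) → ℕ
  | .lit c, _ => c
  | .reg r, ρ => ρ r
  | .mem t, ρ => mem (t.eval N mem ρ)
  | .add a b, ρ => a.eval N mem ρ + b.eval N mem ρ
  | .sub a b, ρ => a.eval N mem ρ - b.eval N mem ρ
  | .ite c a b, ρ => if c.eval N mem ρ ≠ 0 then a.eval N mem ρ else b.eval N mem ρ
  | .sum r t, ρ => ∑ j ∈ Finset.range N, t.eval N mem (Function.update ρ r j)

/-- The term uses only registers below `d`, and register `0` is not bound. -/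
def WF (d : ℕ) : CTerm → Bool
  | .lit _ => true
  | .reg r => decide (r < d)
  | .mem t => t.WF d
  | .add a b => a.WF d && b.WF d
  | .sub a b => a.WF d && b.WF d
  | .ite c a b => c.WF d && a.WF d && b.WF d
  | .sum r t => decide (0 < r) && decide (r < d) && t.WF d

/-- The value depends only on the registers that occur in the term, so scratch registers above
them may be overwritten. -/
theorem eval_congr {N d : ℕ} {mem : ℕ → ℕ} {t : CTerm} (ht : t.WF d = true) :
    ∀ {ρ ρ' : ℕ → ℕ}, (∀ r < d, ρ r = ρ' r) → t.eval N mem ρ = t.eval N mem ρ' := by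
  induction t with
  | lit c => intros; rfl
  | reg r => intro ρ ρ' h; exact h r (by simpa [WF] using ht)
  | mem t ih => intro ρ ρ' h; simp only [eval]; rw [ih ht h]
  | add a b iha ihb =>
    intro ρ ρ' h
    simp only [WF, Bool.and_eq_true] at ht
    simp only [eval]; rw [iha ht.1 h, ihb ht.2 h]
  | sub a b iha ihb =>
    intro ρ ρ' h
    simp only [WF, Bool.and_eq_true] at ht
    simp only [eval]; rw [iha ht.1 h, ihb ht.2 h]
  | ite c a b ihc iha ihb =>
    intro ρ ρ' h
    simp only [WF, Bool.and_eq_true] at ht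
    simp only [eval]; rw [ihc ht.1.1 h, iha ht.1.2 h, ihb ht.2 h]
  | sum r t ih =>
    intro ρ ρ' h
    simp only [WF, Bool.and_eq_true] at ht
    simp only [eval]
    refine Finset.sum_congr rfl fun j _ => ih ht.2 fun r' hr' => ?_
    by_cases hr : r' = r
    · simp [hr]
    · simp [Function.update_of_ne hr, h r' hr']

/-- A program that leaves the value of the term in register `b`. It uses scratch registers from
`b` on and restores the register of every binder. -/
def compile : CTerm → ℕ → Prog
  | .lit c, b => .set b (.lit c)
  | .reg r, b => .set b (.reg r)
  | .mem t, b => .seq (t.compile b) (.set b (.mem (.reg b)))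
  | .add x y, b => .seq (x.compile b) (.seq (y.compile (b + 1))
      (.set b (.add (.reg b) (.reg (b + 1)))))
  | .sub x y, b => .seq (x.compile b) (.seq (y.compile (b + 1))
      (.set b (.sub (.reg b) (.reg (b + 1)))))
  | .ite c x y, b => .seq (c.compile b) (.ite (.reg b) (x.compile b) (y.compile b))
  | .sum r t, b => .seq (.set b (.reg r)) (.seq (.set (b + 1) (.lit 0)) (.seq (.set r (.lit 0))
      (.seq (.loop (.sub (.reg 0) (.reg r)) (.seq (t.compile (b + 2))
        (.seq (.set (b + 1) (.add (.reg (b + 1)) (.reg (b + 2))))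
          (.set r (.add (.reg r) (.lit 1))))))
      (.seq (.set r (.reg b)) (.set b (.reg (b + 1)))))))

/-- A bound on the running time of the compiled term. -/
def cost (N : ℕ) : CTerm → ℕ
  | .lit _ => 2
  | .reg _ => 2
  | .mem t => t.cost N + 3
  | .add a b => a.cost N + (b.cost N + 4)
  | .sub a b => a.cost N + (b.cost N + 4)
  | .ite c a b => c.cost N + (2 + (a.cost N + b.cost N))
  | .sum _ t => N * (t.cost N + 12) + 14

theorem cost_le_pow (t : CTerm) : ∃ K e, ∀ N, 1 ≤ N → t.cost N ≤ K * N ^ e := by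
  have two : ∀ {f g : ℕ → ℕ}, (∃ K e, ∀ N, 1 ≤ N → f N ≤ K * N ^ e) →
      (∃ K e, ∀ N, 1 ≤ N → g N ≤ K * N ^ e) → ∃ K e, ∀ N, 1 ≤ N → f N + g N ≤ K * N ^ e := by
    rintro f g ⟨K, e, h⟩ ⟨K', e', h'⟩
    refine ⟨K + K', e + e', fun N hN => ?_⟩
    have h1 : N ^ e ≤ N ^ (e + e') := Nat.pow_le_pow_right hN (by omega)
    have h2 : N ^ e' ≤ N ^ (e + e') := Nat.pow_le_pow_right hN (by omega)
    have := h N hN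
    have := h' N hN
    nlinarith
  have const : ∀ c : ℕ, ∃ K e, ∀ N, 1 ≤ N → (fun _ : ℕ => c) N ≤ K * N ^ e := fun c =>
    ⟨c, 0, fun N _ => by simp⟩
  induction t with
  | lit c => exact const 2
  | reg r => exact const 2
  | mem t ih => exact two ih (const 3)
  | add a b iha ihb => exact two iha (two ihb (const 4))
  | sub a b iha ihb => exact two iha (two ihb (const 4))
  | ite c a b ihc iha ihb => exact two ihc (two (const 2) (two iha ihb))
  | sum r t ih =>
    refine two ?_ (const 14)
    obtain ⟨K, e, h⟩ := two ih (const 12)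
    refine ⟨K, e + 1, fun N hN => ?_⟩
    calc N * (t.cost N + 12) ≤ N * (K * N ^ e) := Nat.mul_le_mul_left _ (h N hN)
      _ = K * N ^ (e + 1) := by ring

theorem runs_compile {N d : ℕ} (hd : 0 < d) {t : CTerm} (ht : t.WF d = true) :
    ∀ {b : ℕ}, d ≤ b → ∀ {σ : State}, σ.reg 0 = N →
    Runs (t.compile b) σ (t.cost N) fun σ' => σ'.reg b = t.eval N σ.mem σ.reg ∧
      (∀ r < b, σ'.reg r = σ.reg r) ∧ σ'.mem = σ.mem := by
  induction t with
  | lit c =>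
    intro b hb σ hσ
    exact Runs.set ⟨by simp [Expr.eval, eval], fun r hr => update_of_lt hr, rfl⟩
  | reg r =>
    intro b hb σ hσ
    exact Runs.set ⟨by simp [Expr.eval, eval], fun r hr => update_of_lt hr, rfl⟩
  | mem t ih =>
    intro b hb σ hσ
    refine (ih ht hb hσ).seq fun σ₁ ⟨h1, h2, h3⟩ => ?_
    exact Runs.set ⟨by simp [Expr.eval, eval, h1, h3],
      fun r hr => by simp [update_of_lt hr, h2 r hr], h3⟩
  | add a c iha ihc =>
    intro b hb σ hσ
    simp only [WF, Bool.and_eq_true] at ht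
    refine (iha ht.1 hb hσ).seq fun σ₁ ⟨h1, h2, h3⟩ => ?_
    refine (ihc ht.2 (b := b + 1) (by omega) (σ := σ₁) (by rw [h2 0 (by omega), hσ])).seq
      fun σ₂ ⟨g1, g2, g3⟩ => ?_
    refine Runs.set ⟨?_, fun r hr => ?_, g3.trans h3⟩
    · simp only [Function.update_self, Expr.eval, eval]
      rw [g2 b (by omega), h1, g1, h3, eval_congr ht.2 fun r hr => h2 r (by omega)]
    · simp only [update_of_lt hr]
      rw [g2 r (by omega), h2 r hr]
  | sub a c iha ihc =>
    intro b hb σ hσ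
    simp only [WF, Bool.and_eq_true] at ht
    refine (iha ht.1 hb hσ).seq fun σ₁ ⟨h1, h2, h3⟩ => ?_
    refine (ihc ht.2 (b := b + 1) (by omega) (σ := σ₁) (by rw [h2 0 (by omega), hσ])).seq
      fun σ₂ ⟨g1, g2, g3⟩ => ?_
    refine Runs.set ⟨?_, fun r hr => ?_, g3.trans h3⟩
    · simp only [Function.update_self, Expr.eval, eval]
      rw [g2 b (by omega), h1, g1, h3, eval_congr ht.2 fun r hr => h2 r (by omega)]
    · simp only [update_of_lt hr]
      rw [g2 r (by omega), h2 r hr]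
  | ite e a c ihe iha ihc =>
    intro b hb σ hσ
    simp only [WF, Bool.and_eq_true] at ht
    refine (ihe ht.1.1 hb hσ).seq fun σ₁ ⟨h1, h2, h3⟩ => ?_
    have h0 : σ₁.reg 0 = N := by rw [h2 0 (by omega), hσ]
    refine Runs.ite (fun hv => ?_) (fun hv => ?_)
    · refine (iha ht.1.2 hb h0).mono le_rfl fun σ₂ ⟨g1, g2, g3⟩ =>
        ⟨?_, fun r hr => by rw [g2 r hr, h2 r hr], g3.trans h3⟩
      simp only [Expr.eval, h1] at hv
      rw [eval, if_pos hv, g1, h3, eval_congr ht.1.2 fun r hr => h2 r (by omega)]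
    · refine (ihc ht.2 hb h0).mono le_rfl fun σ₂ ⟨g1, g2, g3⟩ =>
        ⟨?_, fun r hr => by rw [g2 r hr, h2 r hr], g3.trans h3⟩
      simp only [Expr.eval, h1] at hv
      rw [eval, if_neg (by simp [hv]), g1, h3, eval_congr ht.2 fun r hr => h2 r (by omega)]
  | sum r t ih =>
    intro b hb σ hσ
    simp only [WF, Bool.and_eq_true, decide_eq_true_eq] at ht
    obtain ⟨⟨hr0, hrd⟩, htd⟩ := ht
    -- before round `i` the bound register holds `i` and register `b + 1` the partial sum
    let Inv : ℕ → State → Prop := fun i σ' => σ'.reg r = i ∧ σ'.reg b = σ.reg r ∧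
      σ'.reg (b + 1) = ∑ j ∈ Finset.range i, t.eval N σ.mem (Function.update σ.reg r j) ∧
      (∀ r' < b, r' ≠ r → σ'.reg r' = σ.reg r') ∧ σ'.mem = σ.mem
    have hloop : ∀ σ₃, Inv 0 σ₃ → Runs (.loop (.sub (.reg 0) (.reg r)) (.seq (t.compile (b + 2))
        (.seq (.set (b + 1) (.add (.reg (b + 1)) (.reg (b + 2))))
          (.set r (.add (.reg r) (.lit 1)))))) σ₃ (N * (t.cost N + 12) + 4) (Inv N) := by
      intro σ₃ h₃
      refine (Runs.loop Inv N (fun _ => t.cost N + (4 + 4)) ?_ ?_ h₃).mono ?_ fun _ h => h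
      · rintro i hi σ₄ ⟨a1, a2, a3, a4, a5⟩
        have h0 : σ₄.reg 0 = N := by rw [a4 0 (by omega) (by omega), hσ]
        refine ⟨by simp only [Expr.eval, h0, a1]; omega, ?_⟩
        refine (ih htd (b := b + 2) (by omega) h0).seq fun σ₅ ⟨g1, g2, g3⟩ => ?_
        refine Runs.seq_set (Runs.set ⟨?_, ?_, ?_, ?_, g3.trans a5⟩)
        · simp only [Function.update_self, Expr.eval]
          rw [update_of_lt (by omega), g2 r (by omega), a1]
        · simp only
          rw [Function.update_of_ne (by omega), update_of_lt (by omega), g2 b (by omega), a2]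
        · simp only [Expr.eval]
          rw [Function.update_of_ne (by omega), Function.update_self, Finset.sum_range_succ,
            g2 _ (by omega), a3, g1, a5]
          congr 1
          refine eval_congr htd fun r' hr' => ?_
          by_cases h : r' = r
          · simp [h, a1]
          · rw [Function.update_of_ne h, a4 r' (by omega) h]
        · intro r' hr' hne
          simp only
          rw [Function.update_of_ne hne, update_of_lt (by omega), g2 r' (by omega), a4 r' hr' hne]
      · rintro σ₄ ⟨a1, a2, a3, a4, a5⟩
        simp only [Expr.eval, a4 0 (by omega) (by omega), hσ, a1, Nat.sub_self]
      · simp only [Expr.cost, Finset.sum_const, Finset.card_range, smul_eq_mul]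
        exact le_of_eq (by ring)
    have hcost : (CTerm.sum r t).cost N =
        2 + (2 + (2 + ((N * (t.cost N + 12) + 4) + (2 + 2)))) := by
      simp only [cost]; ring
    rw [hcost]
    refine Runs.seq_set (Runs.seq_set (Runs.seq_set ?_))
    refine (hloop _ ?_).seq ?_
    · refine ⟨by simp [Expr.eval], ?_, ?_, fun r' hr' hne => ?_, rfl⟩
      · simp only [Expr.eval]
        rw [Function.update_of_ne (by omega), update_of_lt (by omega), Function.update_self]
      · simp only [Expr.eval]
        rw [Function.update_of_ne (by omega), Function.update_self, Finset.sum_range_zero]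
      · simp only
        rw [Function.update_of_ne hne, update_of_lt (by omega), update_of_lt (by omega)]
    · rintro σ₄ ⟨a1, a2, a3, a4, a5⟩
      refine Runs.seq_set (Runs.set ⟨?_, fun r' hr' => ?_, a5⟩)
      · simp only [Function.update_self, Expr.eval, eval]
        rw [Function.update_of_ne (by omega), a3]
      · simp only [Expr.eval]
        rw [update_of_lt hr']
        by_cases h : r' = r
        · rw [h, Function.update_self, a2]
        · rw [Function.update_of_ne h, a4 r' hr' h]

end CTerm
end RAM

namespace RAM

/-! ### Computable functions on random access machines -/

/-- The program `p` reads the arguments of `f` from the registers `ι 0, ι 1, …`, writes its value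
to register `s`, and changes neither the memory nor a register below `s`. -/
def ComputesFrom {n : ℕ} (f T : List.Vector ℕ n → ℕ) (ι : Fin n → ℕ) (s : ℕ) (p : Prog) : Prop :=
  ∀ (v : List.Vector ℕ n) (σ : State), (∀ i, σ.reg (ι i) = v.get i) →
    Runs p σ (T v) fun σ' => σ'.reg s = f v ∧ (∀ r < s, σ'.reg r = σ.reg r) ∧ σ'.mem = σ.mem

/-- `f` can be computed, for every placement of its arguments below the target register, within a
primitive recursive time bound. -/
def PrimTimed {n : ℕ} (f : List.Vector ℕ n → ℕ) : Prop :=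
  ∃ T : List.Vector ℕ n → ℕ, Primrec T ∧
    ∀ (ι : Fin n → ℕ) (s : ℕ), (∀ i, ι i < s) → ∃ p, ComputesFrom f T ι s p

theorem computesFrom_set {n : ℕ} {f : List.Vector ℕ n → ℕ} {ι : Fin n → ℕ} {s : ℕ} (e : Expr)
    (h : ∀ v σ, (∀ i, σ.reg (ι i) = v.get i) → e.eval σ = f v) :
    ComputesFrom f (fun _ => e.cost + 1) ι s (.set s e) := fun v σ hv =>
  Runs.set ⟨by simp [h v σ hv], fun r hr => update_of_lt hr, rfl⟩

/-- Several functions of the same arguments, computed one after the other into consecutive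
registers. -/
theorem exists_computes_many {n : ℕ} (m : ℕ) (g : Fin m → List.Vector ℕ n → ℕ)
    (hg : ∀ i, PrimTimed (g i)) :
    ∃ T : List.Vector ℕ n → ℕ, Primrec T ∧
      ∀ (ι : Fin n → ℕ) (s : ℕ), (∀ i, ι i < s) → ∃ p, ∀ (v : List.Vector ℕ n) (σ : State),
        (∀ i, σ.reg (ι i) = v.get i) →
        Runs p σ (T v) fun σ' => (∀ i : Fin m, σ'.reg (s + i) = g i v) ∧
          (∀ r < s, σ'.reg r = σ.reg r) ∧ σ'.mem = σ.mem := by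
  induction m with
  | zero =>
    refine ⟨fun _ => 2, .const 2, fun ι s hs => ⟨.set s (.lit 0), fun v σ hv => ?_⟩⟩
    exact Runs.set ⟨fun i => i.elim0, fun r hr => update_of_lt hr, rfl⟩
  | succ m ih =>
    obtain ⟨T, hT, h⟩ := ih (fun i => g i.castSucc) fun i => hg _
    obtain ⟨T', hT', h'⟩ := hg (Fin.last m)
    refine ⟨fun v => T v + T' v, Primrec.nat_add.comp hT hT', fun ι s hs => ?_⟩
    obtain ⟨p, hp⟩ := h ι s hs
    obtain ⟨p', hp'⟩ := h' ι (s + m) fun i => (hs i).trans_le (by omega)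
    refine ⟨.seq p p', fun v σ hv => ?_⟩
    refine (hp v σ hv).seq fun σ₁ ⟨a1, a2, a3⟩ => ?_
    refine (hp' v σ₁ fun i => by rw [a2 _ (hs i), hv i]).mono le_rfl
      fun σ₂ ⟨b1, b2, b3⟩ => ⟨fun i => ?_, fun r hr => ?_, b3.trans a3⟩
    · refine Fin.lastCases b1 (fun j => ?_) i
      simp only [Fin.val_castSucc]
      rw [b2 _ (by omega), a1 j]
    · rw [b2 r (by omega), a2 r hr]

theorem _root_.Primrec.sum_range {α : Type*} [Primcodable α] {f : α → ℕ} {g : α → ℕ → ℕ}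
    (hf : Primrec f) (hg : Primrec₂ g) :
    Primrec fun a => ∑ i ∈ Finset.range (f a), g a i := by
  have : Primrec fun a => (f a).rec (motive := fun _ => ℕ) 0 fun n IH => IH + g a n :=
    Primrec.nat_rec' hf (.const 0) (Primrec.nat_add.comp (Primrec.snd.comp .snd)
      (hg.comp .fst (Primrec.fst.comp .snd))).to₂
  refine this.of_eq fun a => ?_
  induction f a with
  | zero => rfl
  | succ n ih => rw [Finset.sum_range_succ, ← ih]

/-- Primitive recursive functions have primitive recursive running times, by induction on their
construction: composition runs programs in sequence, recursion runs one in a loop. -/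
theorem primTimed_of_primrec' {n : ℕ} {f : List.Vector ℕ n → ℕ} (hf : Nat.Primrec' f) :
    PrimTimed f := by
  induction hf with
  | zero =>
    exact ⟨fun _ => 2, .const 2, fun ι s hs => ⟨_, computesFrom_set (.lit 0) fun _ _ _ => rfl⟩⟩
  | succ =>
    exact ⟨fun _ => 4, .const 4, fun ι s hs => ⟨_, computesFrom_set (.add (.reg (ι 0)) (.lit 1))
      fun v σ h => by simp [Expr.eval, h 0]⟩⟩
  | get i =>
    exact ⟨fun _ => 2, .const 2, fun ι s hs => ⟨_, computesFrom_set (.reg (ι i))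
      fun v σ h => h i⟩⟩
  | @comp n m f g hf hg ihf ihg =>
    obtain ⟨T, hT, h⟩ := exists_computes_many m g ihg
    obtain ⟨T', hT', h'⟩ := ihf
    refine ⟨fun v => T v + (T' (List.Vector.ofFn fun i => g i v) + 2),
      Primrec.nat_add.comp hT (Primrec.nat_add.comp
        (hT'.comp (.vector_ofFn fun i => (hg i).to_prim)) (.const 2)), fun ι s hs => ?_⟩
    obtain ⟨p, hp⟩ := h ι s hs
    obtain ⟨p', hp'⟩ := h' (fun i => s + i) (s + m) fun i => by omega
    refine ⟨.seq p (.seq p' (.set s (.reg (s + m)))), fun v σ hv => ?_⟩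
    refine (hp v σ hv).seq fun σ₁ ⟨a1, a2, a3⟩ => ?_
    refine (hp' (List.Vector.ofFn fun i => g i v) σ₁ fun i => by simp [a1 i]).seq
      fun σ₂ ⟨b1, b2, b3⟩ => ?_
    refine Runs.set ⟨by simp [Expr.eval, b1], fun r hr => ?_, b3.trans a3⟩
    simp only
    rw [update_of_lt hr, b2 r (by omega), a2 r hr]
  | @prec n f g hf hg ihf ihg =>
    obtain ⟨T, hT, h⟩ := ihf
    obtain ⟨T', hT', h'⟩ := ihg
    let F : List.Vector ℕ (n + 1) → ℕ → ℕ := fun v y =>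
      y.rec (f v.tail) fun y IH => g (y ::ᵥ IH ::ᵥ v.tail)
    have hF : Primrec₂ F := by
      have hf' : Primrec fun v : List.Vector ℕ (n + 1) => f v.tail :=
        hf.to_prim.comp .vector_tail
      have hg' : Primrec₂ fun (v : List.Vector ℕ (n + 1)) (y : ℕ × ℕ) =>
          g (y.1 ::ᵥ y.2 ::ᵥ v.tail) :=
        hg.to_prim.comp (Primrec.vector_cons.comp (Primrec.fst.comp .snd)
          (Primrec.vector_cons.comp (Primrec.snd.comp .snd) (Primrec.vector_tail.comp .fst)))
      exact Primrec.nat_rec hf' hg'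
    have hsum : Primrec fun v : List.Vector ℕ (n + 1) =>
        ∑ y ∈ Finset.range v.head, (T' (y ::ᵥ F v y ::ᵥ v.tail) + 10) := by
      have harg : Primrec fun a : List.Vector ℕ (n + 1) × ℕ => a.2 ::ᵥ F a.1 a.2 ::ᵥ a.1.tail :=
        Primrec.vector_cons.comp .snd
          (Primrec.vector_cons.comp hF (Primrec.vector_tail.comp .fst))
      exact Primrec.sum_range .vector_head (Primrec.nat_add.comp (hT'.comp harg) (.const 10)).to₂
    refine ⟨fun v => T v.tail + (2 + (2 + (((∑ y ∈ Finset.range v.head,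
        (T' (y ::ᵥ F v y ::ᵥ v.tail) + 10)) + 4) + 2))),
      Primrec.nat_add.comp (hT.comp .vector_tail) (Primrec.nat_add.comp (.const 2)
        (Primrec.nat_add.comp (.const 2) (Primrec.nat_add.comp (Primrec.nat_add.comp hsum
          (.const 4)) (.const 2)))), fun ι s hs => ?_⟩
    obtain ⟨p, hp⟩ := h (fun i => ι i.succ) s fun i => hs _
    obtain ⟨p', hp'⟩ := h' (Fin.cons s (Fin.cons (s + 1) fun i => ι i.succ)) (s + 2) (by
      intro i
      refine Fin.cases (by simp) (fun i => Fin.cases (by simp) (fun i => ?_) i) i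
      have := hs i.succ
      simp only [Fin.cons_succ]; omega)
    -- register `s` counts the rounds, register `s + 1` holds the current value
    refine ⟨.seq p (.seq (.set (s + 1) (.reg s)) (.seq (.set s (.lit 0)) (.seq
      (.loop (.sub (.reg (ι 0)) (.reg s)) (.seq p' (.seq (.set (s + 1) (.reg (s + 2)))
        (.set s (.add (.reg s) (.lit 1)))))) (.set s (.reg (s + 1)))))), fun v σ hv => ?_⟩
    refine (hp v.tail σ fun i => by rw [hv i.succ, List.Vector.get_tail_succ]).seq
      fun σ₁ ⟨a1, a2, a3⟩ => ?_
    let Inv : ℕ → State → Prop := fun y σ' => σ'.reg s = y ∧ σ'.reg (s + 1) = F v y ∧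
      (∀ r < s, σ'.reg r = σ.reg r) ∧ σ'.mem = σ.mem
    refine Runs.seq_set (Runs.seq_set ?_)
    have h₃ : Inv 0 ⟨Function.update (Function.update σ₁.reg (s + 1) (σ₁.reg s)) s 0, σ₁.mem⟩ := by
      refine ⟨by simp, ?_, fun r hr => ?_, a3⟩
      · simp only
        rw [Function.update_of_ne (by omega), Function.update_self, a1]
        rfl
      · simp only
        rw [update_of_lt hr, update_of_lt (by omega), a2 r hr]
    have h0 : ι 0 < s := hs 0
    refine ((Runs.loop Inv v.head (fun y => T' (y ::ᵥ F v y ::ᵥ v.tail) + (2 + 4))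
      ?_ ?_ h₃).mono (T' := (∑ y ∈ Finset.range v.head,
        (T' (y ::ᵥ F v y ::ᵥ v.tail) + 10)) + 4) ?_ fun _ h => h).seq ?_
    · rintro y hy σ₄ ⟨b1, b2, b3, b4⟩
      refine ⟨?_, ?_⟩
      · simp only [Expr.eval, b3 _ h0, b1, hv 0, List.Vector.get_zero]
        omega
      refine (hp' (y ::ᵥ F v y ::ᵥ v.tail) σ₄ ?_).seq fun σ₅ ⟨c1, c2, c3⟩ => ?_
      · intro i
        refine Fin.cases (by simpa using b1) (fun i => Fin.cases (by exact b2)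
          (fun i => ?_) i) i
        simp only [Fin.cons_succ, List.Vector.get_cons_succ]
        rw [b3 _ (hs _), hv, List.Vector.get_tail_succ]
      refine Runs.seq_set (Runs.set ⟨?_, ?_, fun r hr => ?_, c3.trans b4⟩)
      · simp only [Expr.eval, Function.update_self]
        rw [update_of_lt (by omega), c2 s (by omega), b1]
      · simp only
        rw [Function.update_of_ne (by omega), Function.update_self]
        exact c1
      · simp only
        rw [update_of_lt hr, update_of_lt (by omega), c2 r (by omega), b3 r hr]
    · rintro σ₄ ⟨b1, b2, b3, b4⟩
      simp only [Expr.eval, b3 _ h0, b1, hv 0, List.Vector.get_zero, Nat.sub_self]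
    · simp only [Expr.cost]
      refine le_of_eq ?_
      ring_nf
    · rintro σ₄ ⟨b1, b2, b3, b4⟩
      refine Runs.set ⟨by simpa [Expr.eval] using b2, fun r hr => ?_, b4⟩
      simp only
      rw [update_of_lt hr, b3 r hr]

/-- A computable function can be computed within a computable time bound: for a code of the
function, the step-bounded evaluation is primitive recursive, and the program raises the number
of steps until the evaluation succeeds. -/
theorem exists_prog_of_computable {g : ℕ → ℕ} (hg : Computable g) :
    ∃ T : ℕ → ℕ, Computable T ∧ ∀ ι s : ℕ, ι < s → ∃ p, ∀ σ : State,
      Runs p σ (T (σ.reg ι)) fun σ' => σ'.reg s = g (σ.reg ι) ∧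
        (∀ r < s, σ'.reg r = σ.reg r) ∧ σ'.mem = σ.mem := by
  obtain ⟨cd, hcd⟩ := Nat.Partrec.Code.exists_code.1 (Partrec.nat_iff.1 hg)
  let F : ℕ → ℕ → ℕ := fun s k => Encodable.encode (Nat.Partrec.Code.evaln s cd k)
  have hF : Primrec₂ F := by
    have : Primrec fun a : ℕ × ℕ => Nat.Partrec.Code.evaln a.1 cd a.2 :=
      Nat.Partrec.Code.primrec_evaln.comp (Primrec.pair (Primrec.pair .fst (.const cd)) .snd)
    exact Primrec.encode.comp this
  have hFval : ∀ s k, F s k ≠ 0 → F s k = g k + 1 := by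
    intro s k h
    rcases ho : Nat.Partrec.Code.evaln s cd k with _ | x
    · simp [F, ho] at h
    · have hx := Nat.Partrec.Code.evaln_sound (show x ∈ Nat.Partrec.Code.evaln s cd k from ho)
      rw [hcd] at hx
      simp only [PFun.coe_val, Part.mem_some_iff] at hx
      simp [F, ho, hx]
  have hex : ∀ k, ∃ s, F s k ≠ 0 := by
    intro k
    have hx : g k ∈ cd.eval k := by rw [hcd]; simp
    obtain ⟨s, hs⟩ := Nat.Partrec.Code.evaln_complete.1 hx
    refine ⟨s, ?_⟩
    rw [Option.mem_def] at hs
    simp [F, hs]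
  let s₀ : ℕ → ℕ := fun k => Nat.find (hex k)
  have hs₀ : Computable s₀ := by
    have hp : Computable₂ fun (k s : ℕ) => decide (F s k ≠ 0) := by
      have h0 : PrimrecPred fun a : ℕ × ℕ => F a.2 a.1 = 0 :=
        Primrec.eq.comp (hF.comp .snd .fst) (.const 0)
      exact (PrimrecPred.decide h0.not).to_comp
    refine (Partrec.rfind hp.partrec₂).of_eq fun k => ?_
    refine Part.eq_some_iff.2 (Nat.mem_rfind.2 ⟨?_, fun {m} hm => ?_⟩)
    · simpa using Nat.find_spec (hex k)
    · simpa using Nat.find_min (hex k) hm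
  have hF' : Nat.Primrec' fun v : List.Vector ℕ 2 => F v.head v.tail.head :=
    Nat.Primrec'.prim_iff₂.2 hF
  obtain ⟨T, hT, h⟩ := primTimed_of_primrec' hF'
  let T₂ : ℕ → ℕ → ℕ := fun s k => T (s ::ᵥ k ::ᵥ List.Vector.nil)
  have hT₂ : Primrec₂ T₂ := hT.comp (Primrec.vector_cons.comp .fst
    (Primrec.vector_cons.comp .snd (.const List.Vector.nil)))
  have hsum : Primrec fun a : ℕ × ℕ =>
      2 + (T₂ 0 a.2 + ((∑ i ∈ Finset.range a.1, (T₂ (i + 1) a.2 + 8)) + 4 + 4)) := by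
    have h1 : Primrec₂ fun (a : ℕ × ℕ) (i : ℕ) => T₂ (i + 1) a.2 + 8 :=
      Primrec.nat_add.comp (hT₂.comp (Primrec.succ.comp .snd) (Primrec.snd.comp .fst)) (.const 8)
    have h2 := Primrec.sum_range (f := fun a : ℕ × ℕ => a.1) .fst h1
    exact Primrec.nat_add.comp (.const 2) (Primrec.nat_add.comp (hT₂.comp (.const 0) .snd)
      (Primrec.nat_add.comp (Primrec.nat_add.comp h2 (.const 4)) (.const 4)))
  refine ⟨fun k => 2 + (T₂ 0 k + ((∑ i ∈ Finset.range (s₀ k), (T₂ (i + 1) k + 8)) + 4 + 4)),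
    hsum.to_comp.comp (hs₀.pair .id), fun ι s hι => ?_⟩
  obtain ⟨p, hp⟩ := h (Fin.cons s fun _ => ι) (s + 1) (by
    intro i
    refine Fin.cases (by simp) (fun i => ?_) i
    simp only [Fin.cons_succ]; omega)
  refine ⟨.seq (.set s (.lit 0)) (.seq p (.seq (.loop (.sub (.lit 1) (.reg (s + 1)))
    (.seq (.set s (.add (.reg s) (.lit 1))) p)) (.set s (.sub (.reg (s + 1)) (.lit 1))))),
    fun σ => ?_⟩
  obtain ⟨k, hk⟩ : ∃ k, k = σ.reg ι := ⟨_, rfl⟩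
  rw [← hk]
  let Inv : ℕ → State → Prop := fun i σ' => σ'.reg s = i ∧ σ'.reg (s + 1) = F i k ∧
    (∀ r < s, σ'.reg r = σ.reg r) ∧ σ'.mem = σ.mem
  have hstep : ∀ i σ', σ'.reg s = i → (∀ r < s, σ'.reg r = σ.reg r) → σ'.mem = σ.mem →
      Runs p σ' (T₂ i k) (Inv i) := by
    intro i σ' h1 h2 h3
    refine (hp (i ::ᵥ k ::ᵥ List.Vector.nil) σ' fun j => ?_).mono le_rfl fun σ₁ ⟨b1, b2, b3⟩ =>
      ⟨by rw [b2 _ (by omega), h1], b1, fun r hr => by rw [b2 r (by omega), h2 r hr], b3.trans h3⟩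
    refine Fin.cases (by simpa using h1) (fun j => ?_) j
    obtain rfl : j = 0 := Subsingleton.elim _ _
    exact (h2 ι hι).trans hk.symm
  refine Runs.seq_set ?_
  refine Runs.seq (hstep 0 _ ?_ ?_ ?_) fun σ₁ hσ₁ => ?_
  · exact Function.update_self _ _ _
  · exact fun r hr => update_of_lt hr
  · rfl
  refine ((Runs.loop Inv (s₀ k) (fun i => 4 + T₂ (i + 1) k) ?_ ?_ hσ₁).mono
    (T' := (∑ i ∈ Finset.range (s₀ k), (T₂ (i + 1) k + 8)) + 4) ?_ fun _ h => h).seq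
    (T' := 4) ?_
  · rintro i hi σ₂ ⟨b1, b2, b3, b4⟩
    have h0 : F i k = 0 := by simpa using Nat.find_min (hex k) hi
    refine ⟨by simp [Expr.eval, b2, h0], Runs.seq_set (hstep (i + 1) _ ?_ ?_ b4)⟩
    · simp [Expr.eval, b1]
    · exact fun r hr => (update_of_lt hr).trans (b3 r hr)
  · rintro σ₂ ⟨b1, b2, b3, b4⟩
    have := Nat.find_spec (hex k)
    simp only [Expr.eval, b2]
    exact Nat.sub_eq_zero_of_le (Nat.one_le_iff_ne_zero.2 this)
  · simp only [Expr.cost]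
    refine le_of_eq ?_
    ring_nf
  · rintro σ₂ ⟨b1, b2, b3, b4⟩
    refine Runs.set ⟨?_, fun r hr => (update_of_lt hr).trans (b3 r hr), b4⟩
    simp [Expr.eval, b2, hFval _ _ (Nat.find_spec (hex k)), s₀]

end RAM

/-! ### Vertex covers of bipartite graphs -/

open Classical in
/-- A certificate that the bipartite graph with edge relation `E` has no small vertex cover: one
side has `m` vertices of degree at least `m`, or there are `2 * m * m` edges whose two ends
have degree less than `m`. -/
def CoverIsLarge {V : Type} [Fintype V] (E : V → V → Prop) (m : ℕ) : Prop :=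
  m ≤ (Finset.univ.filter fun x => m ≤ (Finset.univ.filter fun y => E x y).card).card ∨
  m ≤ (Finset.univ.filter fun y => m ≤ (Finset.univ.filter fun x => E x y).card).card ∨
  2 * m * m ≤ ∑ x, (Finset.univ.filter fun y => E x y ∧
    ¬ m ≤ (Finset.univ.filter fun y' => E x y').card ∧
    ¬ m ≤ (Finset.univ.filter fun x' => E x' y).card).card

open Classical in
/-- A vertex of degree at least `m` belongs to every vertex cover whose other side has fewer than
`m` vertices, and fewer than `2 * m` vertices of lower degree cover fewer than `2 * m * m` edges. -/
theorem CoverIsLarge.le_card {V : Type} [Fintype V] {E : V → V → Prop} {m : ℕ}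
    (h : CoverIsLarge E m) (X Y : Finset V) (hXY : ∀ x y, E x y → x ∈ X ∨ y ∈ Y) :
    m ≤ X.card ∨ m ≤ Y.card := by
  by_contra! hcon
  obtain ⟨hX, hY⟩ := hcon
  rcases h with h | h | h
  · obtain ⟨x, hx, hxX⟩ := Finset.exists_mem_notMem_of_card_lt_card (hX.trans_le h)
    rw [Finset.mem_filter] at hx
    refine absurd (hx.2.trans (Finset.card_le_card fun y hy => ?_)) (not_le.2 hY)
    exact (hXY x y (Finset.mem_filter.1 hy).2).resolve_left hxX
  · obtain ⟨y, hy, hyY⟩ := Finset.exists_mem_notMem_of_card_lt_card (hY.trans_le h)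
    rw [Finset.mem_filter] at hy
    refine absurd (hy.2.trans (Finset.card_le_card fun x hx => ?_)) (not_le.2 hX)
    exact (hXY x y (Finset.mem_filter.1 hx).2).resolve_right hyY
  · rw [← Finset.card_sigma] at h
    -- the edges of low degree are covered by at most `#X + #Y` stars with at most `m` edges
    have hsub : (Finset.univ.sigma fun x => Finset.univ.filter fun y => E x y ∧
        ¬ m ≤ (Finset.univ.filter fun y' => E x y').card ∧
        ¬ m ≤ (Finset.univ.filter fun x' => E x' y).card) ⊆
        (X.biUnion fun x => if m ≤ (Finset.univ.filter fun y' => E x y').card then ∅ else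
          (Finset.univ.filter fun y => E x y).image fun y => (⟨x, y⟩ : (_ : V) × V)) ∪
        (Y.biUnion fun y => if m ≤ (Finset.univ.filter fun x' => E x' y).card then ∅ else
          (Finset.univ.filter fun x => E x y).image fun x => (⟨x, y⟩ : (_ : V) × V)) := by
      rintro ⟨x, y⟩ hxy
      simp only [Finset.mem_sigma, Finset.mem_univ, true_and, Finset.mem_filter] at hxy
      obtain ⟨hE, h1, h2⟩ := hxy
      rcases hXY x y hE with hx | hy
      · refine Finset.mem_union_left _ (Finset.mem_biUnion.2 ⟨x, hx, ?_⟩)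
        rw [if_neg h1]
        exact Finset.mem_image.2 ⟨y, by simp [hE], rfl⟩
      · refine Finset.mem_union_right _ (Finset.mem_biUnion.2 ⟨y, hy, ?_⟩)
        rw [if_neg h2]
        exact Finset.mem_image.2 ⟨x, by simp [hE], rfl⟩
    have h1 := Finset.card_le_card hsub
    have h2 := Finset.card_union_le
        (X.biUnion fun x => if m ≤ (Finset.univ.filter fun y' => E x y').card then ∅ else
          (Finset.univ.filter fun y => E x y).image fun y => (⟨x, y⟩ : (_ : V) × V))
        (Y.biUnion fun y => if m ≤ (Finset.univ.filter fun x' => E x' y).card then ∅ else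
          (Finset.univ.filter fun x => E x y).image fun x => (⟨x, y⟩ : (_ : V) × V))
    have h3 := Finset.card_biUnion_le_card_mul X (fun x =>
      if m ≤ (Finset.univ.filter fun y' => E x y').card then ∅ else
          (Finset.univ.filter fun y => E x y).image fun y => (⟨x, y⟩ : (_ : V) × V)) m (by
        intro x _
        split_ifs with hd
        · simp
        · exact Finset.card_image_le.trans (by omega))
    have h4 := Finset.card_biUnion_le_card_mul Y (fun y =>
      if m ≤ (Finset.univ.filter fun x' => E x' y).card then ∅ else
          (Finset.univ.filter fun x => E x y).image fun x => (⟨x, y⟩ : (_ : V) × V)) m (by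
        intro x _
        split_ifs with hd
        · simp
        · exact Finset.card_image_le.trans (by omega))
    have h5 : X.card * m < m * m := Nat.mul_lt_mul_of_pos_right hX (by omega)
    have h6 : Y.card * m < m * m := Nat.mul_lt_mul_of_pos_right hY (by omega)
    have h7 : 2 * m * m = m * m + m * m := by ring
    omega

open Classical in
/-- Without the certificate, the vertices of high degree together with one end of each remaining
edge form a vertex cover, which bounds the size of every matching. -/
theorem le_of_matching {V : Type} [Fintype V] {E : V → V → Prop} {m M : ℕ}
    (h : ¬ CoverIsLarge E m) (f g : ℕ → V) (hf : Set.InjOn f (Set.Iio M))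
    (hg : Set.InjOn g (Set.Iio M)) (hE : ∀ j < M, E (f j) (g j)) : M ≤ 2 * m + 2 * m * m := by
  rw [CoverIsLarge, not_or, not_or, not_le, not_le, not_le, ← Finset.card_sigma] at h
  obtain ⟨h1, h2, h3⟩ := h
  have hcov : Finset.range M ⊆
      ((Finset.range M).filter fun j => m ≤ (Finset.univ.filter fun y => E (f j) y).card) ∪
      (((Finset.range M).filter fun j => m ≤ (Finset.univ.filter fun x => E x (g j)).card) ∪
      ((Finset.range M).filter fun j => ¬ m ≤ (Finset.univ.filter fun y => E (f j) y).card ∧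
        ¬ m ≤ (Finset.univ.filter fun x => E x (g j)).card)) := by
    intro j hj
    simp only [Finset.mem_union, Finset.mem_filter, hj, true_and]
    tauto
  have c1 := Finset.card_le_card_of_injOn (s := (Finset.range M).filter fun j =>
      m ≤ (Finset.univ.filter fun y => E (f j) y).card)
      (t := Finset.univ.filter fun x => m ≤ (Finset.univ.filter fun y => E x y).card) f
      (fun j hj => by simpa using (Finset.mem_filter.1 hj).2)
      (hf.mono fun j hj => by simpa using (Finset.mem_filter.1 hj).1)
  have c2 := Finset.card_le_card_of_injOn (s := (Finset.range M).filter fun j =>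
      m ≤ (Finset.univ.filter fun x => E x (g j)).card)
      (t := Finset.univ.filter fun y => m ≤ (Finset.univ.filter fun x => E x y).card) g
      (fun j hj => by simpa using (Finset.mem_filter.1 hj).2)
      (hg.mono fun j hj => by simpa using (Finset.mem_filter.1 hj).1)
  have c3 := Finset.card_le_card_of_injOn (s := (Finset.range M).filter fun j =>
      ¬ m ≤ (Finset.univ.filter fun y => E (f j) y).card ∧
        ¬ m ≤ (Finset.univ.filter fun x => E x (g j)).card)
      (t := Finset.univ.sigma fun x => Finset.univ.filter fun y => E x y ∧
        ¬ m ≤ (Finset.univ.filter fun y' => E x y').card ∧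
        ¬ m ≤ (Finset.univ.filter fun x' => E x' y).card) (fun j => ⟨f j, g j⟩)
      (fun j hj => by
        have hj' := Finset.mem_filter.1 hj
        simp only [Finset.coe_sigma, Set.mem_sigma_iff, Finset.mem_coe, Finset.mem_univ,
          Finset.mem_filter, true_and]
        exact ⟨hE j (Finset.mem_range.1 hj'.1), hj'.2⟩)
      (fun j hj j' hj' hjj' => hf (by simpa using (Finset.mem_filter.1 hj).1)
        (by simpa using (Finset.mem_filter.1 hj').1) (congrArg Sigma.fst hjj'))
  have c4 := (Finset.card_le_card hcov).trans ((Finset.card_union_le _ _).trans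
    (Nat.add_le_add_left (Finset.card_union_le _ _) _))
  rw [Finset.card_range] at c4
  omega

/-! ### Gaps between separators -/

/-- `x` is the last separator before `z` in the order given by `a`. -/
def Follows {V : Type} (a : V → ℕ) (sep mid : V → Prop) (x z : V) : Prop :=
  sep x ∧ mid z ∧ a x < a z ∧ ∀ u, sep u → a x < a u → ¬ a u < a z

theorem exists_follows {V : Type} [Finite V] {a : V → ℕ} {sep mid : V → Prop} {r z : V}
    (hr : sep r) (hz : mid z) (hrz : a r < a z) : ∃ x, Follows a sep mid x z ∧ a r ≤ a x := by
  obtain ⟨x, hx, hmax⟩ := Set.exists_max_image {x | sep x ∧ a x < a z} a (Set.toFinite _)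
    ⟨r, hr, hrz⟩
  exact ⟨x, ⟨hx.1, hz, hx.2, fun u hu hxu huz => absurd (hmax u ⟨hu, huz⟩) (not_le.2 hxu)⟩,
    hmax r ⟨hr, hrz⟩⟩

theorem Follows.lt_of_lt {V : Type} {a : V → ℕ} {sep mid : V → Prop} {x z x' : V}
    (h : Follows a sep mid x z) (hx' : sep x') (hlt : a x < a x')
    (hne : a x' ≠ a z) : a z < a x' :=
  lt_of_le_of_ne (not_lt.1 (h.2.2.2 x' hx' hlt)) hne.symm

/-- Separators and one vertex of the gap behind each of them form interlaced sets. -/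
theorem exists_interlaced {V : Type} [DecidableEq V] {P : List V}
    {sep mid : V → Prop} (hsm : ∀ u, sep u → ¬ mid u) (hs : ∀ u, sep u → u ∈ P)
    (hm : ∀ u, mid u → u ∈ P) {X : Finset V} {z : V → V}
    (hX : ∀ x ∈ X, Follows P.idxOf sep mid x (z x)) :
    Disjoint X (X.image z) ∧ (X.image z).card = X.card ∧ Interlaced P X (X.image z) := by
  have key : ∀ x ∈ X, ∀ x' ∈ X, P.idxOf x < P.idxOf x' → P.idxOf (z x) < P.idxOf x' := by
    intro x hx x' hx' hlt
    refine (hX x hx).lt_of_lt (hX x' hx').1 hlt fun he => ?_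
    rw [List.idxOf_inj (hs _ (hX x' hx').1)] at he
    exact hsm _ (hX x' hx').1 (he ▸ (hX x hx).2.1)
  have hinj : Set.InjOn P.idxOf (X : Set V) := fun x hx y hy hxy =>
    (List.idxOf_inj (hs _ (hX x hx).1)).1 hxy
  refine ⟨?_, Finset.card_image_of_injOn ?_, ?_⟩
  · rw [Finset.disjoint_left]
    intro x hx hxz
    obtain ⟨x', hx', rfl⟩ := Finset.mem_image.1 hxz
    exact hsm _ (hX _ hx).1 (hX x' hx').2.1
  · intro x hx x' hx' he
    rcases lt_trichotomy (P.idxOf x) (P.idxOf x') with h | h | h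
    · have h1 := key x hx x' hx' h
      have h2 : P.idxOf x' < P.idxOf (z x') := (hX x' hx').2.2.1
      rw [he] at h1
      omega
    · exact hinj hx hx' h
    · have h1 := key x' hx' x hx h
      have h2 : P.idxOf x < P.idxOf (z x) := (hX x hx).2.2.1
      rw [← he] at h1
      omega
  · have hcard : (X.image P.idxOf).card = X.card := Finset.card_image_of_injOn hinj
    let e := (X.image P.idxOf).orderIsoOfFin hcard
    have hc : ∀ i, ∃ x ∈ X, P.idxOf x = e i := fun i => Finset.mem_image.1 (e i).2
    choose c hcX hce using hc
    have hcimg : X = Finset.univ.image c := by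
      ext x
      simp only [Finset.mem_image, Finset.mem_univ, true_and]
      refine ⟨fun hx => ⟨e.symm ⟨P.idxOf x, Finset.mem_image_of_mem _ hx⟩, ?_⟩, ?_⟩
      · exact hinj (hcX _) hx ((hce _).trans (by simp))
      · rintro ⟨i, rfl⟩
        exact hcX i
    refine ⟨X.card, c, fun i => z (c i), hcimg, ?_, fun i => ⟨hs _ (hX _ (hcX i)).1,
      hm _ (hX _ (hcX i)).2.1⟩, fun i => (hX _ (hcX i)).2.2.1, fun i j hij => ?_⟩
    · conv_lhs => rw [hcimg]
      rw [Finset.image_image]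
      rfl
    · refine key _ (hcX i) _ (hcX j) ?_
      rw [hce, hce]
      exact e.strictMono hij

/-! ### The quadrants around a vertex -/

/-- `u` is admissible and lies after `v` in both orders. -/
def RowSep {V : Type} (a b : V → ℕ) (pt : V → Prop) (v u : V) : Prop :=
  pt u ∧ a v < a u ∧ b v < b u

/-- `u` is admissible and lies before `v` in both orders. -/
def ColSep {V : Type} (a b : V → ℕ) (pt : V → Prop) (v u : V) : Prop :=
  pt u ∧ a u < a v ∧ b u < b v

/-- `u` is admissible and lies after `v` in the first and before `v` in the second order. -/
def Mixed {V : Type} (a b : V → ℕ) (pt : V → Prop) (v u : V) : Prop :=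
  pt u ∧ a v < a u ∧ b u < b v

/-- The bipartite graph between the gaps of the first order and the gaps of the second order, each
gap named by the separator at its beginning: two gaps are adjacent if they have a mixed vertex
in common. -/
def GapEdge {V : Type} (a b : V → ℕ) (pt : V → Prop) (v x y : V) : Prop :=
  ∃ z, Follows a (RowSep a b pt v) (Mixed a b pt v) x z ∧
    Follows b (ColSep a b pt v) (Mixed a b pt v) y z

/-- A grid of admissible vertices yields a large matching in the gap graph of its middle vertex:
the mixed vertices are taken along a diagonal, separated by every other row and column. -/
theorem exists_matching_of_grid {V : Type} [Finite V] {a b : V → ℕ} {pt : V → Prop}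
    {t L M : ℕ} {p : ℕ → ℕ → V} (hpt : ∀ x < t, ∀ y < t, pt (p x y))
    (ha : ∀ x < t, ∀ y < t, ∀ x' < t, ∀ y' < t, x < x' → a (p x y) < a (p x' y'))
    (hb : ∀ x < t, ∀ y < t, ∀ x' < t, ∀ y' < t, y < y' → b (p x y) < b (p x' y'))
    (hL : 2 * M + 1 ≤ L) (ht : L + 2 * M + 3 ≤ t) :
    ∃ f g : ℕ → V, Set.InjOn f (Set.Iio M) ∧ Set.InjOn g (Set.Iio M) ∧
      ∀ j < M, GapEdge a b pt (p L L) (f j) (g j) := by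
  let v := p L L
  let z : ℕ → V := fun j => p (L + 2 + 2 * j) (2 * j + 1)
  have hz : ∀ j < M, Mixed a b pt v (z j) := fun j hj =>
    ⟨hpt _ (by omega) _ (by omega),
      ha _ (by omega) _ (by omega) _ (by omega) _ (by omega) (by omega),
      hb _ (by omega) _ (by omega) _ (by omega) _ (by omega) (by omega)⟩
  have hr : ∀ j ≤ M, RowSep a b pt v (p (L + 1 + 2 * j) (L + 1)) := fun j hj =>
    ⟨hpt _ (by omega) _ (by omega),
      ha _ (by omega) _ (by omega) _ (by omega) _ (by omega) (by omega),
      hb _ (by omega) _ (by omega) _ (by omega) _ (by omega) (by omega)⟩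
  have hc : ∀ j ≤ M, ColSep a b pt v (p 0 (2 * j)) := fun j hj =>
    ⟨hpt _ (by omega) _ (by omega),
      ha _ (by omega) _ (by omega) _ (by omega) _ (by omega) (by omega),
      hb _ (by omega) _ (by omega) _ (by omega) _ (by omega) (by omega)⟩
  have hf : ∀ j, ∃ x, j < M → Follows a (RowSep a b pt v) (Mixed a b pt v) x (z j) ∧
      a (p (L + 1 + 2 * j) (L + 1)) ≤ a x := by
    intro j
    by_cases hj : j < M
    · obtain ⟨x, hx⟩ := exists_follows (a := a) (hr j hj.le) (hz j hj)
        (ha _ (by omega) _ (by omega) _ (by omega) _ (by omega) (by omega))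
      exact ⟨x, fun _ => hx⟩
    · exact ⟨v, fun h => absurd h hj⟩
  have hg : ∀ j, ∃ y, j < M → Follows b (ColSep a b pt v) (Mixed a b pt v) y (z j) ∧
      b (p 0 (2 * j)) ≤ b y := by
    intro j
    by_cases hj : j < M
    · obtain ⟨x, hx⟩ := exists_follows (a := b) (hc j hj.le) (hz j hj)
        (hb _ (by omega) _ (by omega) _ (by omega) _ (by omega) (by omega))
      exact ⟨x, fun _ => hx⟩
    · exact ⟨v, fun h => absurd h hj⟩
  choose f hf using hf
  choose g hg using hg
  have hfm : ∀ j < M, ∀ j' < M, j < j' → a (f j) < a (f j') := fun j hj j' hj' h =>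
    ((hf j hj).1.2.2.1.trans (ha _ (by omega) _ (by omega) _ (by omega) _ (by omega)
      (by omega))).trans_le (hf j' hj').2
  have hgm : ∀ j < M, ∀ j' < M, j < j' → b (g j) < b (g j') := fun j hj j' hj' h =>
    ((hg j hj).1.2.2.1.trans (hb _ (by omega) _ (by omega) _ (by omega) _ (by omega)
      (by omega))).trans_le (hg j' hj').2
  refine ⟨f, g, fun j hj j' hj' he => ?_, fun j hj j' hj' he => ?_,
    fun j hj => ⟨z j, (hf j hj).1, (hg j hj).1⟩⟩
  · rcases lt_trichotomy j j' with h | h | h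
    · exact absurd (hfm j hj j' hj' h) (by rw [he]; exact lt_irrefl _)
    · exact h
    · exact absurd (hfm j' hj' j hj h) (by rw [he]; exact lt_irrefl _)
  · rcases lt_trichotomy j j' with h | h | h
    · exact absurd (hgm j hj j' hj' h) (by rw [he]; exact lt_irrefl _)
    · exact h
    · exact absurd (hgm j' hj' j hj h) (by rw [he]; exact lt_irrefl _)

/-! ### Monochromatic grids -/

/-- If every cell of a square grid of side `t ^ #K` has one of the colours in `K`, then some
colour occupies a `t`-by-`t` grid: either the first colour occurs in each of the `t`-by-`t`
blocks, or one block avoids it and the remaining colours are treated inside that block. -/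
theorem exists_monochromatic_grid {κ : Type*} [DecidableEq κ] (G : κ → ℕ → ℕ → Prop) (t : ℕ)
    (K : Finset κ) : ∀ x₀ y₀ : ℕ,
    (∀ x < t ^ K.card, ∀ y < t ^ K.card, ∃ c ∈ K, G c (x₀ + x) (y₀ + y)) →
    ∃ c ∈ K, ∃ X Y : ℕ → ℕ → ℕ,
      (∀ x < t, ∀ y < t, X x y < x₀ + t ^ K.card ∧ Y x y < y₀ + t ^ K.card ∧
        G c (X x y) (Y x y)) ∧
      (∀ x < t, ∀ y < t, ∀ x' < t, ∀ y' < t, x < x' → X x y < X x' y') ∧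
      (∀ x < t, ∀ y < t, ∀ x' < t, ∀ y' < t, y < y' → Y x y < Y x' y') := by
  induction K using Finset.induction_on with
  | empty =>
    intro x₀ y₀ h
    obtain ⟨c, hc, -⟩ := h 0 (by simp) 0 (by simp)
    simp at hc
  | insert c K hc ih =>
    intro x₀ y₀ h
    rw [Finset.card_insert_of_notMem hc, pow_succ] at h ⊢
    obtain ⟨s, hs⟩ : ∃ s, s = t ^ K.card := ⟨_, rfl⟩
    rw [← hs] at h ⊢ ih
    have hlt : ∀ {x u : ℕ}, x < t → u < s → s * x + u < s * t := fun {x u} hx hu =>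
      calc s * x + u < s * (x + 1) := by rw [Nat.mul_succ]; omega
        _ ≤ s * t := Nat.mul_le_mul_left _ hx
    by_cases hall : ∀ x y, ∃ u w, x < t → y < t → u < s ∧ w < s ∧
        G c (x₀ + (s * x + u)) (y₀ + (s * y + w))
    · choose U W hUW using hall
      have hmono : ∀ {x u x' u' : ℕ}, x < x' → u < s → s * x + u < s * x' + u' :=
        fun {x u x' u'} hx hu =>
        calc s * x + u < s * (x + 1) := by rw [Nat.mul_succ]; omega
          _ ≤ s * x' := Nat.mul_le_mul_left _ hx
          _ ≤ s * x' + u' := Nat.le_add_right _ _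
      refine ⟨c, Finset.mem_insert_self c K, fun x y => x₀ + (s * x + U x y),
        fun x y => y₀ + (s * y + W x y), fun x hx y hy => ?_, ?_, ?_⟩
      · obtain ⟨h1, h2, h3⟩ := hUW x y hx hy
        exact ⟨Nat.add_lt_add_left (hlt hx h1) _, Nat.add_lt_add_left (hlt hy h2) _, h3⟩
      · intro x hx y hy x' hx' y' hy' hxx'
        exact Nat.add_lt_add_left (hmono hxx' (hUW x y hx hy).1) _
      · intro x hx y hy x' hx' y' hy' hyy'
        exact Nat.add_lt_add_left (hmono hyy' (hUW x y hx hy).2.1) _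
    · push Not at hall
      obtain ⟨x, y, hxy⟩ := hall
      have hx : x < t := (hxy 0 0).1
      have hy : y < t := (hxy 0 0).2.1
      obtain ⟨c', hc', X, Y, h1, h2, h3⟩ := ih (x₀ + s * x) (y₀ + s * y) (by
        intro u hu w hw
        obtain ⟨c', hc', hG⟩ := h (s * x + u) (hlt hx hu) (s * y + w) (hlt hy hw)
        rcases Finset.mem_insert.1 hc' with rfl | hc'
        · exact absurd hG ((hxy u w).2.2 hu hw)
        · exact ⟨c', hc', by rwa [Nat.add_assoc, Nat.add_assoc]⟩)
      refine ⟨c', Finset.mem_insert_of_mem hc', X, Y, fun u hu w hw => ?_, h2, h3⟩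
      obtain ⟨g1, g2, g3⟩ := h1 u hu w hw
      refine ⟨?_, ?_, g3⟩
      · have : s * (x + 1) ≤ s * t := Nat.mul_le_mul_left _ hx
        rw [Nat.mul_succ] at this; omega
      · have : s * (y + 1) ≤ s * t := Nat.mul_le_mul_left _ hy
        rw [Nat.mul_succ] at this; omega

/-! ### Rank divisions of consistency matrices -/

/-- A cell without a nonzero entry has at most one distinct row. -/
theorem exists_entry_of_le_distinctRows {m m' r : ℕ} {M : Matrix (Fin m) (Fin m') Bool}
    (hr : 2 ≤ r) {cutR cutC : Fin (r + 1) → ℕ} {a b : Fin r}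
    (h : r ≤ distinctRows M (divisionPart m cutR a) (divisionPart m' cutC b)) :
    ∃ x ∈ divisionPart m cutR a, ∃ y ∈ divisionPart m' cutC b, M x y = true := by
  by_contra! hcon
  have : distinctRows M (divisionPart m cutR a) (divisionPart m' cutC b) ≤ 1 := by
    refine Finset.card_le_one.2 fun f hf g hg => ?_
    obtain ⟨x, hx, rfl⟩ := Finset.mem_image.1 hf
    obtain ⟨x', hx', rfl⟩ := Finset.mem_image.1 hg
    funext y
    have h1 := hcon x hx y y.2
    have h2 := hcon x' hx' y y.2
    simp only [ne_eq, Bool.not_eq_true] at h1 h2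
    rw [h1, h2]
  omega

theorem idxOf_lt_of_filter {V : Type} [DecidableEq V] {P : List V} (hP : P.Nodup)
    {p : V → Bool} {x x' : Fin (P.filter p).length} (h : x < x') :
    P.idxOf ((P.filter p).get x) < P.idxOf ((P.filter p).get x') := by
  have hpw : P.Pairwise fun u w => P.idxOf u < P.idxOf w := by
    rw [List.pairwise_iff_getElem]
    intro i j hi hj hij
    rwa [hP.idxOf_getElem, hP.idxOf_getElem]
  exact List.pairwise_iff_get.1 (hpw.filter p) x x' h

/-- The cells of a rank division of a consistency matrix contain vertices of both domains, and
vertices of different cells are ordered along the two paths as their cells are. -/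
theorem exists_grid_of_hasRankDivision {n r : ℕ} {P P' : List (Fin n)} (hP : P.Nodup)
    (hP' : P'.Nodup) {D D' : Finset (Fin n)} (h : HasRankDivision (consistencyMatrix P P' D D') r)
    (hr : 2 ≤ r) : ∃ p : ℕ → ℕ → Fin n, (∀ x < r, ∀ y < r, p x y ∈ D ∩ D') ∧
      (∀ x < r, ∀ y < r, ∀ x' < r, ∀ y' < r, x < x' →
        P.idxOf (p x y) < P.idxOf (p x' y')) ∧
      (∀ x < r, ∀ y < r, ∀ x' < r, ∀ y' < r, y < y' →
        P'.idxOf (p x y) < P'.idxOf (p x' y')) := by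
  obtain ⟨cutR, cutC, hR, hC, hcell⟩ := h
  have hcell' : ∀ a b : Fin r, ∃ x ∈ divisionPart _ cutR a, ∃ y ∈ divisionPart _ cutC b,
      consistencyMatrix P P' D D' x y = true := fun a b =>
    exists_entry_of_le_distinctRows hr (hcell a b).1
  choose X hX Y hY hXY using hcell'
  have hlt : ∀ {m : ℕ} {cut : Fin (r + 1) → ℕ}, StrictMono cut → ∀ {a a' : Fin r},
      a < a' → ∀ {x x' : Fin m}, x ∈ divisionPart m cut a → x' ∈ divisionPart m cut a' →
      x < x' := by
    intro m cut hcut a a' haa x x' hx hx'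
    simp only [divisionPart, Finset.mem_filter, Finset.mem_univ, true_and] at hx hx'
    have : cut a.succ ≤ cut a'.castSucc := hcut.monotone (by
      rw [Fin.le_def]; simpa using haa)
    exact Fin.lt_def.2 (by omega)
  have hmem : ∀ a b, (orderedDomain P D).get (X a b) = (orderedDomain P' D').get (Y a b) :=
    fun a b => by simpa [consistencyMatrix] using hXY a b
  have hDD : ∀ a b, (orderedDomain P D).get (X a b) ∈ D ∩ D' := by
    intro a b
    rw [Finset.mem_inter]
    constructor
    · have := List.get_mem (orderedDomain P D) (X a b)
      exact of_decide_eq_true (List.mem_filter.1 this).2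
    · rw [hmem]
      have := List.get_mem (orderedDomain P' D') (Y a b)
      exact of_decide_eq_true (List.mem_filter.1 this).2
  refine ⟨fun x y => if h : x < r ∧ y < r then
    (orderedDomain P D).get (X ⟨x, h.1⟩ ⟨y, h.2⟩) else
    (orderedDomain P D).get (X ⟨0, by omega⟩ ⟨0, by omega⟩), fun x hx y hy => ?_, ?_, ?_⟩
  · simp only [hx, hy, and_self, dite_true]
    exact hDD _ _
  · intro x hx y hy x' hx' y' hy' hlt'
    simp only [hx, hy, hx', hy', and_self, dite_true]
    exact idxOf_lt_of_filter hP (hlt hR.1 (Fin.lt_def.2 hlt') (hX _ _) (hX _ _))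
  · intro x hx y hy x' hx' y' hy' hlt'
    simp only [hx, hy, hx', hy', and_self, dite_true]
    rw [hmem, hmem]
    exact idxOf_lt_of_filter hP' (hlt hC.1 (Fin.lt_def.2 hlt') (hY _ _) (hY _ _))

/-! ### Soybeans and shadowless solutions -/

theorem reaches_of_isChain {V : Type} {G : Digraph V} {S : Finset V} :
    ∀ {l : List V} {a : V}, (a :: l).IsChain G.Adj → (∀ x ∈ a :: l, x ∉ S) →
      ∀ x ∈ a :: l, ReachesAvoiding G S a x
  | [], a, _, hS, x, hx => by
    obtain rfl : x = a := by simpa using hx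
    exact ⟨hS _ hx, .refl⟩
  | y :: l, a, hl, hS, x, hx => by
    rcases List.mem_cons.1 hx with rfl | hx
    · exact ⟨hS _ (by simp), .refl⟩
    · rw [List.isChain_cons_cons] at hl
      have := reaches_of_isChain hl.2 (fun z hz => hS z (List.mem_cons_of_mem _ hz)) x hx
      exact ⟨hS _ (by simp), .head ⟨hl.1, hS y (by simp)⟩ this.2⟩

theorem reaches_last_of_isChain {V : Type} {G : Digraph V} {S : Finset V} {b : V} :
    ∀ {l : List V}, l.IsChain G.Adj → (∀ x ∈ l, x ∉ S) → l.getLast? = some b →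
      ∀ x ∈ l, ReachesAvoiding G S x b
  | [], _, _, _, x, hx => by simp at hx
  | y :: l, hl, hS, hb, x, hx => by
    rcases List.mem_cons.1 hx with rfl | hx
    · exact reaches_of_isChain hl hS b (List.mem_of_getLast? hb)
    · refine reaches_last_of_isChain hl.tail (fun z hz => hS z (List.mem_cons_of_mem _ hz)) ?_ x hx
      rwa [List.getLast?_cons_of_ne_nil (List.ne_nil_of_mem hx)] at hb

theorem IsDiWalk.reaches {V : Type} {G : Digraph V} {S : Finset V} {a b : V} {l : List V}
    (h : IsDiWalk G a b l) (hS : ∀ x ∈ l, x ∉ S) {x : V} (hx : x ∈ l) :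
    ReachesAvoiding G S a x ∧ ReachesAvoiding G S x b := by
  obtain ⟨h1, h2, h3⟩ := h
  refine ⟨?_, reaches_last_of_isChain h3 hS h2 x hx⟩
  cases l with
  | nil => simp at hx
  | cons y l =>
    obtain rfl : y = a := by simpa using h1
    exact reaches_of_isChain h3 hS x hx

theorem ReachesAvoiding.trans {V : Type} {G : Digraph V} {S : Finset V} {a b c : V}
    (h : ReachesAvoiding G S a b) (h' : ReachesAvoiding G S b c) : ReachesAvoiding G S a c :=
  ⟨h.1, h.2.trans h'.2⟩

/-- Among more disjoint soybeans than there are vertices in `T`, one avoids `T`. -/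
theorem HasDisjointSoybeans.exists_avoiding {V : Type} {G : Digraph V} {C D T : Finset V}
    {p : ℕ} (h : HasDisjointSoybeans G C D p) (hT : T.card < p) :
    ∃ a b, a ∉ T ∧ b ∉ T ∧ ∃ c ∈ C, ∃ d ∈ D, ∀ S ⊆ T,
      ReachesAvoiding G S a c ∧ ReachesAvoiding G S c b ∧
      ReachesAvoiding G S a d ∧ ReachesAvoiding G S d b := by
  obtain ⟨Q, Q', hQ, hdisj⟩ := h
  obtain ⟨α, hα⟩ : ∃ α, ∀ x, (x ∈ Q α ∨ x ∈ Q' α) → x ∉ T := by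
    by_contra! hcon
    choose f hf hfT using hcon
    have hinj : Function.Injective f := by
      intro α β hαβ
      by_contra hne
      exact hdisj α β hne (f α) (hf α) (hαβ ▸ hf β)
    have := Finset.card_le_card_of_injOn (s := Finset.univ) (t := T) f (fun x _ => hfT x)
      hinj.injOn
    rw [Finset.card_univ, Fintype.card_fin] at this
    omega
  obtain ⟨⟨a, b, hw, hw'⟩, hCD⟩ := hQ α
  have haQ : a ∈ Q α := List.mem_of_head? hw.1
  have hbQ : b ∈ Q α := List.mem_of_getLast? hw.2.1
  refine ⟨a, b, hα a (.inl haQ), hα b (.inl hbQ), ?_⟩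
  rcases hCD with ⟨⟨c, hcQ, hc⟩, d, hdQ, hd⟩ | ⟨⟨c, hcQ, hc⟩, d, hdQ, hd⟩
  · refine ⟨c, hc, d, hd, fun S hS => ?_⟩
    have h1 := hw.reaches (S := S) (fun x hx hxS => hα x (.inl hx) (hS hxS)) hcQ
    have h2 := hw'.reaches (S := S) (fun x hx hxS => hα x (.inr hx) (hS hxS)) hdQ
    exact ⟨h1.1, h1.2, h2.1, h2.2⟩
  · refine ⟨c, hc, d, hd, fun S hS => ?_⟩
    have h1 := hw'.reaches (S := S) (fun x hx hxS => hα x (.inr hx) (hS hxS)) hcQ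
    have h2 := hw.reaches (S := S) (fun x hx hxS => hα x (.inl hx) (hS hxS)) hdQ
    exact ⟨h1.1, h1.2, h2.1, h2.2⟩

namespace MulticutInstance

variable {n : ℕ}

/-- If `k + 7` disjoint soybeans link `C` and `D`, then for a shadowless solution `S` some
`c ∈ C` and `d ∈ D` are reachable in `G - S` from a common source and reach a common sink: one
soybean avoids `S` and the six terminals, and its two ends are not in the shadow of `S`. -/
theorem exists_common_terminals {I : MulticutInstance n} {S C D : Finset (Fin n)}
    (hS : I.IsSolution S) (hsh : I.IsShadowless S) (h : HasDisjointSoybeans I.G C D (I.k + 7)) :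
    ∃ c ∈ C, ∃ d ∈ D,
      (∃ j, ReachesAvoiding I.G S (I.s j) c ∧ ReachesAvoiding I.G S (I.s j) d) ∧
      ∃ j, ReachesAvoiding I.G S c (I.t j) ∧ ReachesAvoiding I.G S d (I.t j) := by
  let T := S ∪ (Finset.univ.image I.s ∪ Finset.univ.image I.t)
  have hT : T.card < I.k + 7 := by
    have h1 := Finset.card_union_le S (Finset.univ.image I.s ∪ Finset.univ.image I.t)
    have h2 := Finset.card_union_le (Finset.univ.image I.s) (Finset.univ.image I.t)
    have h3 : (Finset.univ.image I.s).card ≤ 3 := by simpa using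
      (Finset.card_image_le (s := Finset.univ) (f := I.s))
    have h4 : (Finset.univ.image I.t).card ≤ 3 := by simpa using
      (Finset.card_image_le (s := Finset.univ) (f := I.t))
    have h5 := hS.1
    change (S ∪ (Finset.univ.image I.s ∪ Finset.univ.image I.t)).card < _
    omega
  have hshT : ∀ x, x ∉ T → (∃ j, ReachesAvoiding I.G S (I.s j) x) ∧
      ∃ j, ReachesAvoiding I.G S x (I.t j) := by
    intro x hx
    refine hsh x (fun h => hx (Finset.mem_union_left _ h)) ?_
    rintro (⟨j, rfl⟩ | ⟨j, rfl⟩) <;> simp [T] at hx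
  obtain ⟨a, b, ha, hb, c, hc, d, hd, hr⟩ := h.exists_avoiding hT
  obtain ⟨h1, h2, h3, h4⟩ := hr S Finset.subset_union_left
  obtain ⟨j, hj⟩ := (hshT a ha).1
  obtain ⟨j', hj'⟩ := (hshT b hb).2
  exact ⟨c, hc, d, hd, ⟨j, hj.trans h1, hj.trans h3⟩, j', h2.trans hj', h4.trans hj'⟩

/-- Admissible vertices: the common vertices of both domains that lie in the same parts of both
partitions as `w`. -/
def SameParts (B B' : Finset (Finset (Fin n))) (D D' : Finset (Fin n)) (w u : Fin n) : Prop :=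
  (u ∈ D ∧ u ∈ D') ∧ (∃ b ∈ B, w ∈ b ∧ u ∈ b) ∧ ∃ b ∈ B', w ∈ b ∧ u ∈ b

/-- Separators of one kind on a path, each followed in its gap by a vertex, number less than
`q k (k + 7)` if no common source and sink can serve a separator and such a vertex. -/
theorem IsAugmentation.card_lt_of_follows {I : MulticutInstance n} {c : ℕ → ℕ}
    {q : ℕ → ℕ → ℕ} {i : Fin 3} {A : Finset (Fin n × Fin n)} {F : Finset (List (Fin n))}
    {B : Finpartition (I.flowVertices F)} (haug : I.IsAugmentation c q i A F B)
    {P : List (Fin n)} (hP : P ∈ F) {S : Finset (Fin n)} (hS : I.IsSolution S)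
    (hsh : I.IsShadowless S) {sep mid bad : Fin n → Prop} (hsm : ∀ u, sep u → ¬ mid u)
    {b : Finset (Fin n)} (hb : b ∈ B.parts) (hs : ∀ u, sep u → u ∈ b ∧ u ∈ P)
    (hm : ∀ u, mid u → u ∈ b ∧ u ∈ P) {X : Finset (Fin n)}
    (hX : ∀ x ∈ X, ∃ z, Follows P.idxOf sep mid x z ∧ bad z)
    (hbad : ∀ x z, sep x → mid z → bad z →
      (∃ j, ReachesAvoiding I.G S (I.s j) x ∧ ReachesAvoiding I.G S (I.s j) z) →
      (∃ j, ReachesAvoiding I.G S x (I.t j) ∧ ReachesAvoiding I.G S z (I.t j)) → False) :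
    X.card < q I.k (I.k + 7) := by
  by_contra! hcard
  have hz : ∀ x, ∃ z, x ∈ X → Follows P.idxOf sep mid x z ∧ bad z := by
    intro x
    by_cases hx : x ∈ X
    · obtain ⟨z, hz⟩ := hX x hx
      exact ⟨z, fun _ => hz⟩
    · exact ⟨x, fun h => absurd h hx⟩
  choose z hz using hz
  obtain ⟨h1, h2, h3⟩ := exists_interlaced hsm (fun u hu => (hs u hu).2) (fun u hu => (hm u hu).2)
    (fun x hx => (hz x hx).1)
  have hsoy := haug.soybeans P hP (I.k + 7) b hb X (X.image z) ?_ ?_ h1 hcard (h2 ▸ hcard) h3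
  · obtain ⟨x, hx, d, hd, hj, hj'⟩ := exists_common_terminals hS hsh hsoy
    obtain ⟨x', hx', rfl⟩ := Finset.mem_image.1 hd
    exact hbad x _ (hz x hx).1.1 (hz x' hx').1.2.1 (hz x' hx').2 hj hj'
  · intro x hx
    have := hs x (hz x hx).1.1
    simp [this.1, this.2]
  · intro d hd
    obtain ⟨x', hx', rfl⟩ := Finset.mem_image.1 hd
    have := hm _ (hz x' hx').1.2.1
    simp [this.1, this.2]

/-- A vertex whose gap graph has no small vertex cover is irrelevant. With `j` the third terminal
pair, every mixed vertex is cut off from `s j` or cuts `t j` off. Vertices after `v` on both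
paths are reachable only from `s j`, so few row gaps contain a mixed vertex not reachable from
`s j`; vertices before `v` on both paths reach only `t j`, so few column gaps contain a mixed
vertex that does not reach `t j`. These gaps cover all edges. -/
theorem not_exists_solution_of_coverIsLarge {I : MulticutInstance n} {c : ℕ → ℕ}
    {q : ℕ → ℕ → ℕ} {i i' : Fin 3} (hii : i ≠ i') {A A' : Finset (Fin n × Fin n)}
    {F F' : Finset (List (Fin n))} {B : Finpartition (I.flowVertices F)}
    {B' : Finpartition (I.flowVertices F')} (haug : I.IsAugmentation c q i A F B)
    (haug' : I.IsAugmentation c q i' A' F' B') {P P' : List (Fin n)} (hP : P ∈ F) (hP' : P' ∈ F')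
    {D D' : Finset (Fin n)} (hD : D ⊆ P.toFinset \ I.undel) (hD' : D' ⊆ P'.toFinset \ I.undel)
    {v w : Fin n} (hw : w ∈ D ∩ D')
    (h : CoverIsLarge (GapEdge P.idxOf P'.idxOf (SameParts B.parts B'.parts D D' w) v)
      (q I.k (I.k + 7))) :
    ¬ ∃ S : Finset (Fin n), I.IsSolution S ∧ I.IsShadowless S ∧ v ∈ S ∧
      I.SplitsAt S i P v ∧ I.SplitsAt S i' P' v := by
  classical
  rintro ⟨S, hS, hsh, -, hsp, hsp'⟩
  have third : ∀ i i' : Fin 3, i ≠ i' → ∃ j, ∀ l, l = i ∨ l = i' ∨ l = j := by decide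
  obtain ⟨j, hj⟩ := third i i' hii
  rw [Finset.mem_inter] at hw
  have hPm : ∀ u ∈ D, u ∈ P := fun u hu => by
    simpa using (Finset.mem_sdiff.1 (hD hu)).1
  have hPm' : ∀ u ∈ D', u ∈ P' := fun u hu => by
    simpa using (Finset.mem_sdiff.1 (hD' hu)).1
  obtain ⟨b, hb, hwb⟩ : ∃ b ∈ B.parts, w ∈ b := B.exists_mem <| by
    have := Finset.mem_sdiff.1 (hD hw.1)
    exact Finset.mem_sdiff.2 ⟨Finset.mem_biUnion.2 ⟨P, hP, this.1⟩, this.2⟩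
  obtain ⟨b', hb', hwb'⟩ : ∃ b ∈ B'.parts, w ∈ b := B'.exists_mem <| by
    have := Finset.mem_sdiff.1 (hD' hw.2)
    exact Finset.mem_sdiff.2 ⟨Finset.mem_biUnion.2 ⟨P', hP', this.1⟩, this.2⟩
  have hpt : ∀ u, SameParts B.parts B'.parts D D' w u →
      (u ∈ b ∧ u ∈ P) ∧ (u ∈ b' ∧ u ∈ P') := by
    rintro u ⟨hu, ⟨b₁, hb₁, hw₁, hu₁⟩, b₂, hb₂, hw₂, hu₂⟩
    obtain rfl := B.eq_of_mem_parts hb₁ hb hw₁ hwb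
    obtain rfl := B'.eq_of_mem_parts hb₂ hb' hw₂ hwb'
    exact ⟨⟨hu₁, hPm u hu.1⟩, hu₂, hPm' u hu.2⟩
  let X : Finset (Fin n) := Finset.univ.filter fun x => ∃ z,
    Follows P.idxOf (RowSep P.idxOf P'.idxOf (SameParts B.parts B'.parts D D' w) v)
      (Mixed P.idxOf P'.idxOf (SameParts B.parts B'.parts D D' w) v) x z ∧
    ¬ ReachesAvoiding I.G S (I.s j) z
  let Y : Finset (Fin n) := Finset.univ.filter fun y => ∃ z,
    Follows P'.idxOf (ColSep P.idxOf P'.idxOf (SameParts B.parts B'.parts D D' w) v)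
      (Mixed P.idxOf P'.idxOf (SameParts B.parts B'.parts D D' w) v) y z ∧
    ¬ ReachesAvoiding I.G S z (I.t j)
  have hXc : X.card < q I.k (I.k + 7) := by
    refine haug.card_lt_of_follows hP hS hsh
      (sep := RowSep P.idxOf P'.idxOf (SameParts B.parts B'.parts D D' w) v)
      (mid := Mixed P.idxOf P'.idxOf (SameParts B.parts B'.parts D D' w) v)
      (fun u hu hu' => lt_asymm hu.2.2 hu'.2.2)
      hb (fun u hu => (hpt u hu.1).1) (fun u hu => (hpt u hu.1).1)
      (fun x hx => (Finset.mem_filter.1 hx).2) ?_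
    rintro x z hx hz hzj ⟨l, hlx, hlz⟩ -
    rcases hj l with rfl | rfl | rfl
    · exact hsp.2 x (hpt x hx.1).1.2 hx.2.1 hlx
    · exact hsp'.2 x (hpt x hx.1).2.2 hx.2.2 hlx
    · exact hzj hlz
  have hYc : Y.card < q I.k (I.k + 7) := by
    refine haug'.card_lt_of_follows hP' hS hsh
      (sep := ColSep P.idxOf P'.idxOf (SameParts B.parts B'.parts D D' w) v)
      (mid := Mixed P.idxOf P'.idxOf (SameParts B.parts B'.parts D D' w) v)
      (fun u hu hu' => lt_asymm hu.2.1 hu'.2.1)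
      hb' (fun u hu => (hpt u hu.1).2) (fun u hu => (hpt u hu.1).2)
      (fun x hx => (Finset.mem_filter.1 hx).2) ?_
    rintro x z hx hz hzj - ⟨l, hlx, hlz⟩
    rcases hj l with rfl | rfl | rfl
    · exact hsp.1 x (hpt x hx.1).1.2 hx.2.1 hlx
    · exact hsp'.1 x (hpt x hx.1).2.2 hx.2.2 hlx
    · exact hzj hlz
  have hcover : ∀ x y,
      GapEdge P.idxOf P'.idxOf (SameParts B.parts B'.parts D D' w) v x y → x ∈ X ∨ y ∈ Y := by
    rintro x y ⟨z, hxz, hyz⟩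
    by_cases hz : ReachesAvoiding I.G S (I.s j) z
    · refine .inr (Finset.mem_filter.2 ⟨Finset.mem_univ _, z, hyz, fun hz' => ?_⟩)
      exact hS.2.2 j (hz.trans hz')
    · exact .inl (Finset.mem_filter.2 ⟨Finset.mem_univ _, z, hxz, hz⟩)
  rcases h.le_card X Y hcover with h | h <;> omega

end MulticutInstance

namespace MulticutInstance

variable {n : ℕ}

/-- The side of a monochromatic grid that forces a matching of more than `2 * m + 2 * m * m`
edges in the gap graph of its middle vertex. -/
def gridSide (m : ℕ) : ℕ := 4 * (2 * m + 2 * m * m + 1) + 4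

/-- Large grid rank yields a vertex whose gap graph has no small vertex cover: the pairs of parts
are the colours of the cells, and a monochromatic grid contains a large matching. -/
theorem exists_coverIsLarge_of_lt_gridRank {U U' : Finset (Fin n)} (B : Finpartition U)
    (B' : Finpartition U') {c m : ℕ} (hB : B.parts.card ≤ c)
    (hB' : B'.parts.card ≤ c) {P P' : List (Fin n)} (hP : P.Nodup) (hP' : P'.Nodup)
    {D D' : Finset (Fin n)} (hD : D ⊆ U) (hD' : D' ⊆ U')
    (h : gridSide m ^ (c * c) + 1 ≤ gridRank (consistencyMatrix P P' D D')) :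
    ∃ v ∈ D ∩ D', ∃ w ∈ D ∩ D',
      CoverIsLarge (GapEdge P.idxOf P'.idxOf (SameParts B.parts B'.parts D D' w) v) m := by
  classical
  have hr : HasRankDivision (consistencyMatrix P P' D D')
      (gridRank (consistencyMatrix P P' D D')) := by
    refine Nat.sSup_mem (s := {r | HasRankDivision (consistencyMatrix P P' D D') r}) ?_
      ⟨_, fun r hr => HasRankDivision.le_rows hr⟩
    by_contra hne
    rw [Set.not_nonempty_iff_eq_empty] at hne
    rw [gridRank, hne] at h
    simp at h
  obtain ⟨t, ht⟩ : ∃ t, t = gridSide m := ⟨_, rfl⟩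
  rw [← ht] at h
  have hle : t ^ (B.parts ×ˢ B'.parts).card ≤ t ^ (c * c) := by
    refine Nat.pow_le_pow_right (by rw [ht, gridSide]; omega) ?_
    rw [Finset.card_product]
    exact Nat.mul_le_mul hB hB'
  have h1 : 1 ≤ t ^ (c * c) := Nat.one_le_pow _ _ (by rw [ht, gridSide]; omega)
  obtain ⟨p, hp, hpa, hpb⟩ := exists_grid_of_hasRankDivision hP hP' hr (by omega)
  obtain ⟨⟨b, b'⟩, hbb, X, Y, hXY, hX, hY⟩ := exists_monochromatic_grid
    (fun (κ : Finset (Fin n) × Finset (Fin n)) x y => p x y ∈ κ.1 ∧ p x y ∈ κ.2) t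
    (B.parts ×ˢ B'.parts) 0 0 (by
      intro x hx y hy
      have hmem := Finset.mem_inter.1 (hp x (by omega) y (by omega))
      obtain ⟨b, hb, hpb⟩ := B.exists_mem (hD hmem.1)
      obtain ⟨b', hb', hpb'⟩ := B'.exists_mem (hD' hmem.2)
      exact ⟨(b, b'), Finset.mem_product.2 ⟨hb, hb'⟩, by simpa using hpb, by simpa using hpb'⟩)
  rw [Finset.mem_product] at hbb
  have hlt : ∀ x < t, ∀ y < t, X x y < gridRank (consistencyMatrix P P' D D') ∧
      Y x y < gridRank (consistencyMatrix P P' D D') := by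
    intro x hx y hy
    obtain ⟨g1, g2, -⟩ := hXY x hx y hy
    omega
  let L := 2 * (2 * m + 2 * m * m + 1) + 1
  have hLt : L < t := by
    simp only [L, ht, gridSide]; omega
  let v := p (X L L) (Y L L)
  have hv : v ∈ D ∩ D' := hp _ (hlt L hLt L hLt).1 _ (hlt L hLt L hLt).2
  have hpt : ∀ x < t, ∀ y < t, SameParts B.parts B'.parts D D' v (p (X x y) (Y x y)) := by
    intro x hx y hy
    refine ⟨Finset.mem_inter.1 (hp _ (hlt x hx y hy).1 _ (hlt x hx y hy).2),
      ⟨b, hbb.1, (hXY L hLt L hLt).2.2.1, (hXY x hx y hy).2.2.1⟩,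
      ⟨b', hbb.2, (hXY L hLt L hLt).2.2.2, (hXY x hx y hy).2.2.2⟩⟩
  obtain ⟨f, g, hf, hg, hE⟩ := exists_matching_of_grid (a := P.idxOf) (b := P'.idxOf)
    (pt := SameParts B.parts B'.parts D D' v) (t := t) (L := L) (M := 2 * m + 2 * m * m + 1)
    (p := fun x y => p (X x y) (Y x y)) hpt
    (fun x hx y hy x' hx' y' hy' hlt' => hpa _ (hlt x hx y hy).1 _ (hlt x hx y hy).2 _
      (hlt x' hx' y' hy').1 _ (hlt x' hx' y' hy').2 (hX x hx y hy x' hx' y' hy' hlt'))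
    (fun x hx y hy x' hx' y' hy' hlt' => hpb _ (hlt x hx y hy).1 _ (hlt x hx y hy).2 _
      (hlt x' hx' y' hy').1 _ (hlt x' hx' y' hy').2 (hY x hx y hy x' hx' y' hy' hlt'))
    le_rfl (by simp only [L, ht, gridSide]; omega)
  refine ⟨v, hv, v, hv, ?_⟩
  by_contra hcon
  have := le_of_matching hcon f g hf hg hE
  omega

end MulticutInstance

/-! ### Reading the encoded input -/

theorem List.getElem?_flatMap_of_length_eq {α β : Type*} {f : α → List β} {n j : ℕ} (hj : j < n) :
    ∀ {l : List α} {i : ℕ} (hi : i < l.length), (∀ x ∈ l, (f x).length = n) →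
      (l.flatMap f)[i * n + j]? = (f l[i])[j]?
  | [], _, hi, _ => absurd hi (by simp)
  | x :: l, 0, _, h => by
    rw [List.flatMap_cons, List.getElem?_append_left (by rw [h x (by simp)]; omega)]
    simp
  | x :: l, i + 1, hi, h => by
    have hx : (f x).length = n := h x (by simp)
    have hidx : (i + 1) * n + j = n + (i * n + j) := by ring
    rw [List.flatMap_cons, List.getElem?_append_right (by rw [hx, hidx]; omega), hx, hidx,
      Nat.add_sub_cancel_left, List.getElem?_flatMap_of_length_eq hj (by simpa using hi)
        fun y hy => h y (List.mem_cons_of_mem _ hy)]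
    simp

theorem truthWord_ne_zero {p : Prop} : truthWord p ≠ 0 ↔ p := by
  simp [truthWord]

theorem length_setWords {n : ℕ} (X : Finset (Fin n)) : (setWords X).length = n := by
  simp [setWords]

theorem length_relWords {n : ℕ} (R : Fin n → Fin n → Prop) : (relWords R).length = n * n := by
  simp [relWords, List.length_flatMap]

theorem length_pathWords {n : ℕ} (P : List (Fin n)) : (pathWords P).length = P.length + 1 := by
  simp [pathWords]

theorem getD_setWords {n : ℕ} (X : Finset (Fin n)) (u : Fin n) :
    (setWords X).getD u 0 = truthWord (u ∈ X) := by
  simp [setWords, List.getD_eq_getElem?_getD]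

theorem getD_relWords {n : ℕ} (R : Fin n → Fin n → Prop) (u v : Fin n) :
    (relWords R).getD (u * n + v) 0 = truthWord (R u v) := by
  rw [List.getD_eq_getElem?_getD, relWords,
    List.getElem?_flatMap_of_length_eq v.2 (by simp) (by simp)]
  simp

theorem getD_pathWords_zero {n : ℕ} (P : List (Fin n)) : (pathWords P).getD 0 0 = P.length := by
  simp [pathWords]

theorem getD_pathWords_succ {n : ℕ} (P : List (Fin n)) {j : ℕ} (hj : j < P.length) :
    (pathWords P).getD (1 + j) 0 = P[j] := by
  simp [pathWords, Nat.add_comm 1 j, List.getD_eq_getElem?_getD, hj]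

/-- The memory `mem` holds tables of `R` and `R'`, indicators of `D` and `D'` and the paths `P`
and `P'` at the addresses `ρ 3, …, ρ 8`; `ρ 2` holds the number of vertices. All the data fit
below `N`. -/
structure Layout {n : ℕ} (N : ℕ) (mem ρ : ℕ → ℕ) (R R' : Fin n → Fin n → Prop)
    (D D' : Finset (Fin n)) (P P' : List (Fin n)) : Prop where
  size : ρ 2 = n
  le : n ≤ N
  length_le : P.length ≤ N
  length_le' : P'.length ≤ N
  rel : ∀ u v : Fin n, mem (ρ 3 + (u * n + v)) = truthWord (R u v)
  rel' : ∀ u v : Fin n, mem (ρ 4 + (u * n + v)) = truthWord (R' u v)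
  dom : ∀ u : Fin n, mem (ρ 5 + u) = truthWord (u ∈ D)
  dom' : ∀ u : Fin n, mem (ρ 6 + u) = truthWord (u ∈ D')
  len : mem (ρ 7) = P.length
  len' : mem (ρ 8) = P'.length
  path : ∀ j (hj : j < P.length), mem (ρ 7 + (1 + j)) = P[j]
  path' : ∀ j (hj : j < P'.length), mem (ρ 8 + (1 + j)) = P'[j]

/-- Reading the middle one of three consecutive lists. -/
theorem getD_append_append {A X Y : List ℕ} {a j : ℕ} (ha : A.length = a) (hj : j < X.length) :
    (A ++ (X ++ Y)).getD (a + j) 0 = X.getD j 0 := by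
  rw [List.getD_append_right _ _ _ _ (by omega), ha, Nat.add_sub_cancel_left,
    List.getD_append _ _ _ _ hj]

theorem layout_inputWords {n : ℕ} (I : MulticutInstance n) (i i' : Fin 3)
    (B B' : Finset (Finset (Fin n))) (D D' : Finset (Fin n)) (P P' : List (Fin n)) {ρ : ℕ → ℕ}
    (h2 : ρ 2 = n) (h3 : ρ 3 = 10 + n + n * n) (h4 : ρ 4 = ρ 3 + n * n) (h5 : ρ 5 = ρ 4 + n * n)
    (h6 : ρ 6 = ρ 5 + n) (h7 : ρ 7 = ρ 6 + n) (h8 : ρ 8 = ρ 7 + (P.length + 1)) :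
    Layout (inputWords I i i' B B' D D' P P').length
      (fun a => (inputWords I i i' B B' D D' P P').getD a 0) ρ
      (fun u v => ∃ b ∈ B, u ∈ b ∧ v ∈ b) (fun u v => ∃ b ∈ B', u ∈ b ∧ v ∈ b) D D' P P' := by
  have hword : ∀ u v : Fin n, (u : ℕ) * n + v < n * n := fun u v =>
    calc (u : ℕ) * n + v < u * n + n := Nat.add_lt_add_left v.2 _
      _ = (u + 1) * n := by ring
      _ ≤ n * n := Nat.mul_le_mul_right _ u.2
  have hlen : (inputWords I i i' B B' D D' P P').length =
      10 + n + n * n + n * n + n * n + n + n + (P.length + 1) + (P'.length + 1) := by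
    simp [inputWords, partitionWords, length_setWords, length_relWords, length_pathWords]
    ring
  -- the input, split before each table
  let W₃ : List ℕ := [n, I.k, I.s 0, I.s 1, I.s 2, I.t 0, I.t 1, I.t 2, i, i'] ++
    setWords I.undel ++ relWords I.G.Adj
  have l₃ : W₃.length = ρ 3 := by
    simp [W₃, length_setWords, length_relWords, h3]
    ring
  let W₄ := W₃ ++ partitionWords B
  have l₄ : W₄.length = ρ 4 := by simp [W₄, l₃, partitionWords, length_relWords, h4]
  let W₅ := W₄ ++ partitionWords B'
  have l₅ : W₅.length = ρ 5 := by simp [W₅, l₄, partitionWords, length_relWords, h5]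
  let W₆ := W₅ ++ setWords D
  have l₆ : W₆.length = ρ 6 := by simp [W₆, l₅, length_setWords, h6]
  let W₇ := W₆ ++ setWords D'
  have l₇ : W₇.length = ρ 7 := by simp [W₇, l₆, length_setWords, h7]
  let W₈ := W₇ ++ pathWords P
  have l₈ : W₈.length = ρ 8 := by simp [W₈, l₇, length_pathWords, h8]
  have e₈ : inputWords I i i' B B' D D' P P' = W₈ ++ (pathWords P' ++ []) := by
    rw [List.append_nil]; rfl
  have e₇ : inputWords I i i' B B' D D' P P' = W₇ ++ (pathWords P ++ pathWords P') := by
    rw [← List.append_assoc]; rfl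
  have e₆ : inputWords I i i' B B' D D' P P' =
      W₆ ++ (setWords D' ++ (pathWords P ++ pathWords P')) := by
    rw [← List.append_assoc]; exact e₇
  have e₅ : inputWords I i i' B B' D D' P P' =
      W₅ ++ (setWords D ++ (setWords D' ++ (pathWords P ++ pathWords P'))) := by
    rw [← List.append_assoc]; exact e₆
  have e₄ : inputWords I i i' B B' D D' P P' = W₄ ++ (partitionWords B' ++
      (setWords D ++ (setWords D' ++ (pathWords P ++ pathWords P')))) := by
    rw [← List.append_assoc]; exact e₅
  have e₃ : inputWords I i i' B B' D D' P P' = W₃ ++ (partitionWords B ++ (partitionWords B' ++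
      (setWords D ++ (setWords D' ++ (pathWords P ++ pathWords P'))))) := by
    rw [← List.append_assoc]; exact e₄
  refine ⟨h2, by rw [hlen]; omega, by rw [hlen]; omega, by rw [hlen]; omega,
    fun u v => ?_, fun u v => ?_, fun u => ?_, fun u => ?_, ?_, ?_, fun j hj => ?_, fun j hj => ?_⟩
  · simp only [e₃]
    rw [getD_append_append l₃ (by rw [partitionWords, length_relWords]; exact hword u v),
      partitionWords, getD_relWords]
  · simp only [e₄]
    rw [getD_append_append l₄ (by rw [partitionWords, length_relWords]; exact hword u v),
      partitionWords, getD_relWords]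
  · simp only [e₅]
    rw [getD_append_append l₅ (by rw [length_setWords]; exact u.2), getD_setWords]
  · simp only [e₆]
    rw [getD_append_append l₆ (by rw [length_setWords]; exact u.2), getD_setWords]
  · simp only [e₇]
    rw [← Nat.add_zero (ρ 7), getD_append_append l₇ (by rw [length_pathWords]; omega),
      getD_pathWords_zero]
  · simp only [e₈]
    rw [← Nat.add_zero (ρ 8), getD_append_append l₈ (by rw [length_pathWords]; omega),
      getD_pathWords_zero]
  · simp only [e₇]
    rw [getD_append_append l₇ (by rw [length_pathWords]; omega), getD_pathWords_succ _ hj]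
  · simp only [e₈]
    rw [getD_append_append l₈ (by rw [length_pathWords]; omega), getD_pathWords_succ _ hj]

/-! ### The certificate as a counting term -/

namespace RAM

namespace CTerm

/-- Negation, where nonzero values stand for truth. -/
def not (t : CTerm) : CTerm := .sub (.lit 1) t

/-- Conjunction; if the first argument holds, the value is that of the second one. -/
def and (a b : CTerm) : CTerm := .ite a b (.lit 0)

/-- The comparison `a < b`: truncated subtraction is nonzero exactly then. -/
def lt (a b : CTerm) : CTerm := .sub b a

/-- The comparison `a ≤ b`. -/
def le (a b : CTerm) : CTerm := not (lt b a)

/-- Equality of values. -/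
def eq (a b : CTerm) : CTerm := not (.add (.sub a b) (.sub b a))

/-- The sum over all vertices; register `2` holds their number. -/
def sumV (r : ℕ) (t : CTerm) : CTerm := .sum r (.and (.lt (.reg r) (.reg 2)) t)

/-- The number of vertices with a property. -/
def countV (r : ℕ) (t : CTerm) : CTerm := .sumV r (.and t (.lit 1))

variable {N : ℕ} {mem ρ : ℕ → ℕ}

theorem eval_not {t : CTerm} : t.not.eval N mem ρ ≠ 0 ↔ ¬ t.eval N mem ρ ≠ 0 := by
  simp only [not, eval]; omega

theorem eval_and {a b : CTerm} :
    (a.and b).eval N mem ρ ≠ 0 ↔ a.eval N mem ρ ≠ 0 ∧ b.eval N mem ρ ≠ 0 := by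
  simp only [and, eval]; split_ifs <;> simp_all

theorem eval_add {a b : CTerm} :
    (CTerm.add a b).eval N mem ρ ≠ 0 ↔ a.eval N mem ρ ≠ 0 ∨ b.eval N mem ρ ≠ 0 := by
  simp only [eval]; omega

theorem eval_lt {a b : CTerm} :
    (lt a b).eval N mem ρ ≠ 0 ↔ a.eval N mem ρ < b.eval N mem ρ := by
  simp only [lt, eval]; omega

theorem eval_le {a b : CTerm} :
    (le a b).eval N mem ρ ≠ 0 ↔ a.eval N mem ρ ≤ b.eval N mem ρ := by
  rw [le, eval_not, eval_lt, not_lt]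

theorem eval_eq {a b : CTerm} :
    (eq a b).eval N mem ρ ≠ 0 ↔ a.eval N mem ρ = b.eval N mem ρ := by
  rw [eq, eval_not]; simp only [eval]; omega

theorem eval_sum_ne_zero {r : ℕ} {t : CTerm} :
    (CTerm.sum r t).eval N mem ρ ≠ 0 ↔
      ∃ j < N, t.eval N mem (Function.update ρ r j) ≠ 0 := by
  simp only [eval, ne_eq, Finset.sum_eq_zero_iff, Finset.mem_range, not_forall, exists_prop]

theorem eval_sumV {n r : ℕ} {t : CTerm} (h2 : ρ 2 = n) (hN : n ≤ N) (hr : r ≠ 2)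
    {f : Fin n → ℕ} (hf : ∀ u : Fin n, t.eval N mem (Function.update ρ r u) = f u) :
    (sumV r t).eval N mem ρ = ∑ u, f u := by
  simp only [← hf]
  rw [← Finset.sum_range fun j => t.eval N mem (Function.update ρ r j)]
  simp only [sumV, eval, and, lt, Function.update_self, Function.update_of_ne hr.symm, h2]
  rw [← Finset.sum_subset (Finset.range_mono hN) (fun j _ hj => ?_)]
  · refine Finset.sum_congr rfl fun j hj => if_pos ?_
    have := Finset.mem_range.1 hj
    omega
  · rw [if_neg]
    rw [Finset.mem_range] at hj
    omega

open Classical in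
theorem eval_countV {n r : ℕ} {t : CTerm} (h2 : ρ 2 = n) (hN : n ≤ N) (hr : r ≠ 2)
    {Q : Fin n → Prop}
    (hQ : ∀ u : Fin n, t.eval N mem (Function.update ρ r u) ≠ 0 ↔ Q u) :
    (countV r t).eval N mem ρ = (Finset.univ.filter Q).card := by
  rw [countV, eval_sumV (f := fun u => if Q u then 1 else 0) h2 hN hr, Finset.sum_boole]
  · simp
  · intro u
    simp only [and, eval, hQ]

theorem eval_countV_ne_zero {n r : ℕ} {t : CTerm} (h2 : ρ 2 = n) (hN : n ≤ N) (hr : r ≠ 2)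
    {Q : Fin n → Prop}
    (hQ : ∀ u : Fin n, t.eval N mem (Function.update ρ r u) ≠ 0 ↔ Q u) :
    (countV r t).eval N mem ρ ≠ 0 ↔ ∃ u, Q u := by
  classical
  rw [eval_countV h2 hN hr hQ, Finset.card_ne_zero]
  simp [Finset.Nonempty]

end CTerm

open CTerm

/-! The terms below use fixed registers. Register `0` holds the input length, `1` and `9` the
thresholds `m` and `2 * m * m`, `2` the number of vertices, `3` to `8` the addresses of the two
partition tables, the two domains and the two paths. Registers `10` to `15`, `18` and `20` are
vertex variables, among them `10` for the candidate `v` and `11` for the vertex `w` that names a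
pair of parts; `16`, `17` and `19` are bound inside look-ups only, so no vertex variable may use
them. -/

/-- The entry in row `r`, column `r'` of the vertex table that starts at the address in register
`o`. -/
def tableTerm (o r r' : ℕ) : CTerm :=
  .mem (.add (.reg o) (.add (.sum 19 (.and (.lt (.reg 19) (.reg r)) (.reg 2))) (.reg r')))

/-- The vertex in register `r` occurs before the one in register `r'` on the path stored at the
address in register `o`. -/
def beforeTerm (o r r' : ℕ) : CTerm :=
  .sum 16 (.sum 17 (.and (.lt (.reg 16) (.reg 17)) (.and (.lt (.reg 17) (.mem (.reg o)))
    (.and (.eq (.mem (.add (.reg o) (.add (.lit 1) (.reg 16)))) (.reg r))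
      (.eq (.mem (.add (.reg o) (.add (.lit 1) (.reg 17)))) (.reg r'))))))

/-- The vertex in register `r` lies in both domains. -/
def domTerm (r : ℕ) : CTerm :=
  .and (.mem (.add (.reg 5) (.reg r))) (.mem (.add (.reg 6) (.reg r)))

/-- The vertex in register `r` is admissible for the one in register `11`. -/
def admissibleTerm (r : ℕ) : CTerm :=
  .and (domTerm r) (.and (tableTerm 3 11 r) (tableTerm 4 11 r))

/-- The vertex in register `r` is a row separator (`RowSep`) for the one in register `10`. -/
def rowSepTerm (r : ℕ) : CTerm :=
  .and (admissibleTerm r) (.and (beforeTerm 7 10 r) (beforeTerm 8 10 r))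

/-- The vertex in register `r` is a column separator (`ColSep`) for the one in register `10`. -/
def colSepTerm (r : ℕ) : CTerm :=
  .and (admissibleTerm r) (.and (beforeTerm 7 r 10) (beforeTerm 8 r 10))

/-- The vertex in register `r` is mixed (`Mixed`) for the one in register `10`. -/
def mixedTerm (r : ℕ) : CTerm :=
  .and (admissibleTerm r) (.and (beforeTerm 7 10 r) (beforeTerm 8 r 10))

/-- The relation `Follows` between the vertices in registers `x` and `z`, on the path stored at the
address in register `o`. -/
def followsTerm (o : ℕ) (sep mid : ℕ → CTerm) (x z : ℕ) : CTerm :=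
  .and (sep x) (.and (mid z) (.and (beforeTerm o x z)
    (.not (.countV 15 (.and (sep 15) (.and (beforeTerm o x 15) (beforeTerm o 15 z)))))))

/-- The relation `GapEdge` between the vertices in registers `x` and `y`. -/
def gapEdgeTerm (x y : ℕ) : CTerm :=
  .countV 14 (.and (followsTerm 7 rowSepTerm mixedTerm x 14)
    (followsTerm 8 colSepTerm mixedTerm y 14))

/-- The gap of the row separator in register `12` has degree at least the threshold. -/
def richRowTerm : CTerm := .le (.reg 1) (.countV 18 (gapEdgeTerm 12 18))

/-- The gap of the column separator in register `13` has degree at least the threshold. -/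
def richColTerm : CTerm := .le (.reg 1) (.countV 18 (gapEdgeTerm 18 13))

/-- The property `CoverIsLarge` of the gap graph, with the thresholds in registers `1` and `9`. -/
def coverIsLargeTerm : CTerm :=
  .add (.le (.reg 1) (.countV 12 richRowTerm)) (.add (.le (.reg 1) (.countV 13 richColTerm))
    (.le (.reg 9) (.sumV 12 (.countV 13 (.and (gapEdgeTerm 12 13)
      (.and (.not richRowTerm) (.not richColTerm)))))))

/-- The vertex in register `10` has a certificate, for some vertex in register `11` that names a
pair of parts. -/
def certificateTerm : CTerm :=
  .and (domTerm 10) (.countV 11 (.and (domTerm 11) coverIsLargeTerm))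

/-- One plus the first vertex with a certificate, computed as one plus the number of vertices such
that neither they nor a vertex before them has one, or zero if there is none. -/
def outputTerm : CTerm :=
  .ite (.countV 10 certificateTerm) (.add (.lit 1)
    (.countV 20 (.not (.countV 10 (.and (.le (.reg 10) (.reg 20)) certificateTerm))))) (.lit 0)

theorem outputTerm_wf : outputTerm.WF 21 = true := by rfl

end RAM

section

open RAM RAM.CTerm

variable {n N m : ℕ} {mem ρ : ℕ → ℕ} {R R' : Fin n → Fin n → Prop}
  {B B' : Finset (Finset (Fin n))} {D D' : Finset (Fin n)} {P P' : List (Fin n)} {v w : Fin n}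

theorem Layout.update (h : Layout N mem ρ R R' D D' P P') {r : ℕ} (hr : 10 ≤ r) (x : ℕ) :
    Layout N mem (Function.update ρ r x) R R' D D' P P' := by
  have e : ∀ s < 10, Function.update ρ r x s = ρ s := fun s hs =>
    Function.update_of_ne (by omega) _ _
  constructor
  · rw [e 2 (by omega)]; exact h.size
  · exact h.le
  · exact h.length_le
  · exact h.length_le'
  · rw [e 3 (by omega)]; exact h.rel
  · rw [e 4 (by omega)]; exact h.rel'
  · rw [e 5 (by omega)]; exact h.dom
  · rw [e 6 (by omega)]; exact h.dom'
  · rw [e 7 (by omega)]; exact h.len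
  · rw [e 8 (by omega)]; exact h.len'
  · rw [e 7 (by omega)]; exact h.path
  · rw [e 8 (by omega)]; exact h.path'

theorem eval_tableTerm {o r r' : ℕ} {u u' : Fin n} {Q : Fin n → Fin n → Prop} (h2 : ρ 2 = n)
    (hN : n ≤ N) (hQ : ∀ u v : Fin n, mem (ρ o + (u * n + v)) = truthWord (Q u v))
    (hr : ρ r = u) (hr' : ρ r' = u') (hr19 : r ≠ 19) :
    (tableTerm o r r').eval N mem ρ ≠ 0 ↔ Q u u' := by
  have hmul : (CTerm.sum 19 (.and (.lt (.reg 19) (.reg r)) (.reg 2))).eval N mem ρ = u * n := by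
    simp only [eval, CTerm.and, CTerm.lt, Function.update_self, Function.update_of_ne hr19,
      Function.update_of_ne (show 2 ≠ 19 by omega), h2, hr]
    rw [← Finset.sum_subset (Finset.range_mono (u.2.le.trans hN)) (fun j _ hj => ?_),
      Finset.sum_congr rfl (g := fun _ => n) fun j hj => if_pos ?_]
    · simp
    · have := Finset.mem_range.1 hj
      omega
    · rw [Finset.mem_range] at hj
      rw [if_neg (by omega)]
  change mem (ρ o + ((CTerm.sum 19 (.and (.lt (.reg 19) (.reg r)) (.reg 2))).eval N mem ρ +
    ρ r')) ≠ 0 ↔ _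
  rw [hmul, hr', hQ, truthWord_ne_zero]

theorem eval_beforeTerm {o r r' : ℕ} {L : List (Fin n)} {u u' : Fin n} (hL : L.Nodup)
    (hN : L.length ≤ N) (hlen : mem (ρ o) = L.length)
    (hpath : ∀ j (hj : j < L.length), mem (ρ o + (1 + j)) = L[j])
    (hr : ρ r = u) (hr' : ρ r' = u') (ho : o < 10) (h : r ≠ 16 ∧ r ≠ 17) (h' : r' ≠ 16 ∧ r' ≠ 17)
    (hu : u ∈ L) (hu' : u' ∈ L) :
    (beforeTerm o r r').eval N mem ρ ≠ 0 ↔ L.idxOf u < L.idxOf u' := by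
  have e : ∀ i j, ∀ s, s ≠ 16 → s ≠ 17 →
      Function.update (Function.update ρ 16 i) 17 j s = ρ s := fun i j s h1 h2 => by
    rw [Function.update_of_ne h2, Function.update_of_ne h1]
  have key : ∀ i j, (CTerm.and (.lt (.reg 16) (.reg 17)) (.and (.lt (.reg 17) (.mem (.reg o)))
    (.and (.eq (.mem (.add (.reg o) (.add (.lit 1) (.reg 16)))) (.reg r))
      (.eq (.mem (.add (.reg o) (.add (.lit 1) (.reg 17)))) (.reg r'))))).eval N mem
      (Function.update (Function.update ρ 16 i) 17 j) ≠ 0 ↔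
      i < j ∧ j < L.length ∧ mem (ρ o + (1 + i)) = u ∧ mem (ρ o + (1 + j)) = u' := by
    intro i j
    simp only [eval_and, eval_lt, eval_eq, eval, e i j o (by omega) (by omega), e i j r h.1 h.2,
      e i j r' h'.1 h'.2, Function.update_self, Function.update_of_ne (show 16 ≠ 17 by omega),
      hlen, hr, hr']
  rw [beforeTerm, eval_sum_ne_zero]
  simp only [eval_sum_ne_zero, key]
  constructor
  · rintro ⟨i, -, j, -, hij, hj, hi', hj'⟩
    rw [hpath i (by omega), Fin.val_inj] at hi'
    rw [hpath j hj, Fin.val_inj] at hj'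
    rw [← hi', ← hj', hL.idxOf_getElem, hL.idxOf_getElem]
    exact hij
  · intro hlt
    have h1 := List.idxOf_lt_length_of_mem hu
    have h2 := List.idxOf_lt_length_of_mem hu'
    exact ⟨_, by omega, _, by omega, hlt, h2, by rw [hpath _ h1, List.getElem_idxOf],
      by rw [hpath _ h2, List.getElem_idxOf]⟩

theorem eval_domTerm (h : Layout N mem ρ R R' D D' P P') {r : ℕ} {u : Fin n} (hr : ρ r = u) :
    (domTerm r).eval N mem ρ ≠ 0 ↔ u ∈ D ∧ u ∈ D' := by
  rw [domTerm, eval_and]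
  simp only [eval, hr, h.dom, h.dom', truthWord_ne_zero]

/-- The registers hold the layout of the input, the thresholds and the vertices `v` and `w`. -/
structure CertEnv (N : ℕ) (mem ρ : ℕ → ℕ) (B B' : Finset (Finset (Fin n)))
    (D D' : Finset (Fin n)) (P P' : List (Fin n)) (m : ℕ) (v w : Fin n) : Prop where
  layout : Layout N mem ρ (fun u v => ∃ b ∈ B, u ∈ b ∧ v ∈ b)
    (fun u v => ∃ b ∈ B', u ∈ b ∧ v ∈ b) D D' P P'
  nodup : P.Nodup
  nodup' : P'.Nodup
  sub : ∀ u ∈ D, u ∈ P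
  sub' : ∀ u ∈ D', u ∈ P'
  thr : ρ 1 = m
  thr' : ρ 9 = 2 * m * m
  pivot : ρ 10 = v
  part : ρ 11 = w
  mem_dom : v ∈ D ∧ v ∈ D'

/-- The registers of vertex variables: not an auxiliary variable of a path or table look-up. -/
def IsVar (r : ℕ) : Prop := r ≠ 16 ∧ r ≠ 17 ∧ r ≠ 19

namespace CertEnv

theorem update (h : CertEnv N mem ρ B B' D D' P P' m v w) {r : ℕ} (hr : 12 ≤ r) (x : ℕ) :
    CertEnv N mem (Function.update ρ r x) B B' D D' P P' m v w := by
  have e : ∀ s < 12, Function.update ρ r x s = ρ s := fun s hs =>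
    Function.update_of_ne (by omega) _ _
  exact ⟨h.layout.update (by omega) x, h.nodup, h.nodup', h.sub, h.sub',
    by rw [e 1 (by omega), h.thr], by rw [e 9 (by omega), h.thr'],
    by rw [e 10 (by omega), h.pivot], by rw [e 11 (by omega), h.part], h.mem_dom⟩

theorem eval_before (h : CertEnv N mem ρ B B' D D' P P' m v w) {r r' : ℕ} {u u' : Fin n}
    (hr : ρ r = u) (hr' : ρ r' = u') (hv : IsVar r) (hv' : IsVar r') (hu : u ∈ D ∧ u ∈ D')
    (hu' : u' ∈ D ∧ u' ∈ D') :
    ((beforeTerm 7 r r').eval N mem ρ ≠ 0 ↔ P.idxOf u < P.idxOf u') ∧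
    ((beforeTerm 8 r r').eval N mem ρ ≠ 0 ↔ P'.idxOf u < P'.idxOf u') :=
  ⟨eval_beforeTerm h.nodup h.layout.length_le h.layout.len h.layout.path hr hr' (by omega)
    ⟨hv.1, hv.2.1⟩ ⟨hv'.1, hv'.2.1⟩ (h.sub _ hu.1) (h.sub _ hu'.1),
  eval_beforeTerm h.nodup' h.layout.length_le' h.layout.len' h.layout.path' hr hr' (by omega)
    ⟨hv.1, hv.2.1⟩ ⟨hv'.1, hv'.2.1⟩ (h.sub' _ hu.2) (h.sub' _ hu'.2)⟩

theorem eval_admissible (h : CertEnv N mem ρ B B' D D' P P' m v w) {r : ℕ} {u : Fin n}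
    (hr : ρ r = u) :
    (admissibleTerm r).eval N mem ρ ≠ 0 ↔ MulticutInstance.SameParts B B' D D' w u := by
  rw [admissibleTerm, eval_and, eval_and, eval_domTerm h.layout hr,
    eval_tableTerm h.layout.size h.layout.le h.layout.rel h.part hr (by omega),
    eval_tableTerm h.layout.size h.layout.le h.layout.rel' h.part hr (by omega)]
  rfl

theorem eval_rowSep (h : CertEnv N mem ρ B B' D D' P P' m v w) {r : ℕ} {u : Fin n}
    (hr : ρ r = u) (hv : IsVar r) : (rowSepTerm r).eval N mem ρ ≠ 0 ↔
      RowSep P.idxOf P'.idxOf (MulticutInstance.SameParts B B' D D' w) v u := by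
  rw [rowSepTerm, eval_and, eval_and, h.eval_admissible hr, RowSep]
  refine and_congr_right fun hu => ?_
  have := h.eval_before h.pivot hr (by simp [IsVar]) hv h.mem_dom hu.1
  rw [this.1, this.2]

theorem eval_colSep (h : CertEnv N mem ρ B B' D D' P P' m v w) {r : ℕ} {u : Fin n}
    (hr : ρ r = u) (hv : IsVar r) : (colSepTerm r).eval N mem ρ ≠ 0 ↔
      ColSep P.idxOf P'.idxOf (MulticutInstance.SameParts B B' D D' w) v u := by
  rw [colSepTerm, eval_and, eval_and, h.eval_admissible hr, ColSep]
  refine and_congr_right fun hu => ?_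
  have := h.eval_before hr h.pivot hv (by simp [IsVar]) hu.1 h.mem_dom
  rw [this.1, this.2]

theorem eval_mixed (h : CertEnv N mem ρ B B' D D' P P' m v w) {r : ℕ} {u : Fin n}
    (hr : ρ r = u) (hv : IsVar r) : (mixedTerm r).eval N mem ρ ≠ 0 ↔
      Mixed P.idxOf P'.idxOf (MulticutInstance.SameParts B B' D D' w) v u := by
  rw [mixedTerm, eval_and, eval_and, h.eval_admissible hr, Mixed]
  refine and_congr_right fun hu => ?_
  rw [(h.eval_before h.pivot hr (by simp [IsVar]) hv h.mem_dom hu.1).1,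
    (h.eval_before hr h.pivot hv (by simp [IsVar]) hu.1 h.mem_dom).2]

theorem eval_follows {o : ℕ} {a : Fin n → ℕ} {sepT midT : ℕ → CTerm} {sep mid : Fin n → Prop}
    (hpos : ∀ {ρ r r'} {u u' : Fin n}, CertEnv N mem ρ B B' D D' P P' m v w → ρ r = u →
      ρ r' = u' → IsVar r → IsVar r' → u ∈ D ∧ u ∈ D' → u' ∈ D ∧ u' ∈ D' →
      ((beforeTerm o r r').eval N mem ρ ≠ 0 ↔ a u < a u'))
    (hsep : ∀ {ρ r} {u : Fin n}, CertEnv N mem ρ B B' D D' P P' m v w → ρ r = u → IsVar r →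
      ((sepT r).eval N mem ρ ≠ 0 ↔ sep u))
    (hmid : ∀ {ρ r} {u : Fin n}, CertEnv N mem ρ B B' D D' P P' m v w → ρ r = u → IsVar r →
      ((midT r).eval N mem ρ ≠ 0 ↔ mid u))
    (hsepD : ∀ u, sep u → u ∈ D ∧ u ∈ D') (hmidD : ∀ u, mid u → u ∈ D ∧ u ∈ D')
    (h : CertEnv N mem ρ B B' D D' P P' m v w) {r r' : ℕ} {x z : Fin n} (hr : ρ r = x)
    (hr' : ρ r' = z) (hv : IsVar r) (hv' : IsVar r') (h15 : r ≠ 15) (h15' : r' ≠ 15) :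
    (followsTerm o sepT midT r r').eval N mem ρ ≠ 0 ↔ Follows a sep mid x z := by
  rw [followsTerm, eval_and, eval_and, eval_and, hsep h hr hv, hmid h hr' hv', Follows]
  refine and_congr_right fun hx => and_congr_right fun hz => ?_
  rw [hpos h hr hr' hv hv' (hsepD x hx) (hmidD z hz), eval_not]
  refine and_congr_right fun _ => ?_
  rw [eval_countV_ne_zero (Q := fun u => sep u ∧ a x < a u ∧ a u < a z) h.layout.size h.layout.le
    (by omega)]
  · push Not
    rfl
  · intro u
    have hE := h.update (r := 15) (by omega) u
    have e15 : Function.update ρ 15 (u : ℕ) 15 = u := Function.update_self _ _ _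
    have er : Function.update ρ 15 (u : ℕ) r = x := by rw [Function.update_of_ne h15, hr]
    have er' : Function.update ρ 15 (u : ℕ) r' = z := by rw [Function.update_of_ne h15', hr']
    rw [eval_and, eval_and, hsep hE e15 (by simp [IsVar])]
    refine and_congr_right fun hu => ?_
    rw [hpos hE er e15 hv (by simp [IsVar]) (hsepD x hx) (hsepD u hu),
      hpos hE e15 er' (by simp [IsVar]) hv' (hsepD u hu) (hmidD z hz)]

theorem eval_gapEdge (h : CertEnv N mem ρ B B' D D' P P' m v w) {r r' : ℕ} {x y : Fin n}
    (hr : ρ r = x) (hr' : ρ r' = y) (hv : IsVar r) (hv' : IsVar r')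
    (h15 : r ≠ 15 ∧ r ≠ 14) (h15' : r' ≠ 15 ∧ r' ≠ 14) :
    (gapEdgeTerm r r').eval N mem ρ ≠ 0 ↔
      GapEdge P.idxOf P'.idxOf (MulticutInstance.SameParts B B' D D' w) v x y := by
  rw [gapEdgeTerm, GapEdge]
  refine eval_countV_ne_zero h.layout.size h.layout.le (by omega) fun z => ?_
  have hE := h.update (r := 14) (by omega) z
  have e14 : Function.update ρ 14 (z : ℕ) 14 = z := Function.update_self _ _ _
  have er : Function.update ρ 14 (z : ℕ) r = x := by rw [Function.update_of_ne h15.2, hr]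
  have er' : Function.update ρ 14 (z : ℕ) r' = y := by rw [Function.update_of_ne h15'.2, hr']
  rw [eval_and]
  refine and_congr ?_ ?_
  · exact eval_follows (fun hE hr hr' hv hv' hu hu' => (hE.eval_before hr hr' hv hv' hu hu').1)
      (fun hE hr hv => hE.eval_rowSep hr hv) (fun hE hr hv => hE.eval_mixed hr hv)
      (fun u hu => hu.1.1) (fun u hu => hu.1.1) hE er e14 hv
      (by simp [IsVar]) h15.1 (by omega)
  · exact eval_follows (fun hE hr hr' hv hv' hu hu' => (hE.eval_before hr hr' hv hv' hu hu').2)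
      (fun hE hr hv => hE.eval_colSep hr hv) (fun hE hr hv => hE.eval_mixed hr hv)
      (fun u hu => hu.1.1) (fun u hu => hu.1.1) hE er' e14 hv'
      (by simp [IsVar]) h15'.1 (by omega)

open Classical in
theorem eval_richRow (h : CertEnv N mem ρ B B' D D' P P' m v w) {x : Fin n} (hx : ρ 12 = x) :
    richRowTerm.eval N mem ρ ≠ 0 ↔ m ≤ (Finset.univ.filter fun y =>
      GapEdge P.idxOf P'.idxOf (MulticutInstance.SameParts B B' D D' w) v x y).card := by
  rw [richRowTerm, eval_le, eval_countV h.layout.size h.layout.le (by omega), eval, h.thr]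
  intro y
  exact (h.update (by omega) y).eval_gapEdge
    (by rw [Function.update_of_ne (by omega), hx]) (Function.update_self _ _ _)
    (by simp [IsVar]) (by simp [IsVar]) (by omega) (by omega)

open Classical in
theorem eval_richCol (h : CertEnv N mem ρ B B' D D' P P' m v w) {y : Fin n} (hy : ρ 13 = y) :
    richColTerm.eval N mem ρ ≠ 0 ↔ m ≤ (Finset.univ.filter fun x =>
      GapEdge P.idxOf P'.idxOf (MulticutInstance.SameParts B B' D D' w) v x y).card := by
  rw [richColTerm, eval_le, eval_countV h.layout.size h.layout.le (by omega), eval, h.thr]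
  intro x
  exact (h.update (by omega) x).eval_gapEdge (Function.update_self _ _ _)
    (by rw [Function.update_of_ne (by omega), hy])
    (by simp [IsVar]) (by simp [IsVar]) (by omega) (by omega)

theorem eval_coverIsLarge (h : CertEnv N mem ρ B B' D D' P P' m v w) :
    coverIsLargeTerm.eval N mem ρ ≠ 0 ↔ CoverIsLarge
      (GapEdge P.idxOf P'.idxOf (MulticutInstance.SameParts B B' D D' w) v) m := by
  classical
  let E := GapEdge P.idxOf P'.idxOf (MulticutInstance.SameParts B B' D D' w) v
  have hsum : (sumV 12 (.countV 13 (.and (gapEdgeTerm 12 13)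
      (.and (.not richRowTerm) (.not richColTerm))))).eval N mem ρ =
      ∑ x, (Finset.univ.filter fun y => E x y ∧ ¬ m ≤ (Finset.univ.filter fun y' => E x y').card ∧
        ¬ m ≤ (Finset.univ.filter fun x' => E x' y).card).card := by
    refine eval_sumV h.layout.size h.layout.le (by omega) fun x => ?_
    have hx := h.update (r := 12) (by omega) x
    rw [eval_countV (Q := fun y => E x y ∧ ¬ m ≤ (Finset.univ.filter fun y' => E x y').card ∧
      ¬ m ≤ (Finset.univ.filter fun x' => E x' y).card) hx.layout.size hx.layout.le (by omega)]
    · congr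
    intro y
    have hy := hx.update (r := 13) (by omega) y
    have e12 : Function.update (Function.update ρ 12 (x : ℕ)) 13 (y : ℕ) 12 = x := by
      rw [Function.update_of_ne (by omega), Function.update_self]
    have e13 : Function.update (Function.update ρ 12 (x : ℕ)) 13 (y : ℕ) 13 = y :=
      Function.update_self _ _ _
    rw [eval_and, eval_and, eval_not, eval_not, hy.eval_richRow e12, hy.eval_richCol e13,
      hy.eval_gapEdge e12 e13 (by simp [IsVar]) (by simp [IsVar]) (by omega) (by omega)]
  rw [coverIsLargeTerm, eval_add, eval_add, eval_le, eval_le, eval_le, CoverIsLarge,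
    eval_countV h.layout.size h.layout.le (by omega) fun x =>
      (h.update (r := 12) (by omega) x).eval_richRow (Function.update_self _ _ _),
    eval_countV h.layout.size h.layout.le (by omega) fun y =>
      (h.update (r := 13) (by omega) y).eval_richCol (Function.update_self _ _ _),
    eval, h.thr, eval, h.thr', hsum]
  convert Iff.rfl

end CertEnv

/-- The output term finds a vertex with a certificate if there is one. -/
theorem eval_outputTerm
    (h : Layout N mem ρ (fun u v => ∃ b ∈ B, u ∈ b ∧ v ∈ b)
      (fun u v => ∃ b ∈ B', u ∈ b ∧ v ∈ b) D D' P P')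
    (hP : P.Nodup) (hP' : P'.Nodup) (hD : ∀ u ∈ D, u ∈ P) (hD' : ∀ u ∈ D', u ∈ P')
    (h1 : ρ 1 = m) (h9 : ρ 9 = 2 * m * m) :
    (outputTerm.eval N mem ρ = 0 ∧ ¬ ∃ v ∈ D ∩ D', ∃ w ∈ D ∩ D', CoverIsLarge
      (GapEdge P.idxOf P'.idxOf (MulticutInstance.SameParts B B' D D' w) v) m) ∨
    ∃ v ∈ D ∩ D', outputTerm.eval N mem ρ = v + 1 ∧ ∃ w ∈ D ∩ D', CoverIsLarge
      (GapEdge P.idxOf P'.idxOf (MulticutInstance.SameParts B B' D D' w) v) m := by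
  classical
  let Cert : Fin n → Prop := fun v => v ∈ D ∩ D' ∧ ∃ w ∈ D ∩ D', CoverIsLarge
      (GapEdge P.idxOf P'.idxOf (MulticutInstance.SameParts B B' D D' w) v) m
  have hcert : ∀ {ρ : ℕ → ℕ} {v : Fin n}, Layout N mem ρ (fun u v => ∃ b ∈ B, u ∈ b ∧ v ∈ b)
      (fun u v => ∃ b ∈ B', u ∈ b ∧ v ∈ b) D D' P P' → ρ 1 = m → ρ 9 = 2 * m * m → ρ 10 = v →
      (certificateTerm.eval N mem ρ ≠ 0 ↔ Cert v) := by
    intro ρ v h h1 h9 h10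
    rw [certificateTerm, eval_and, eval_domTerm h h10, ← Finset.mem_inter]
    refine and_congr_right fun hv => eval_countV_ne_zero h.size h.le (by omega) fun w => ?_
    have h' := h.update (r := 11) (by omega) w
    rw [eval_and, eval_domTerm h' (Function.update_self _ _ _), ← Finset.mem_inter]
    refine and_congr_right fun hw => CertEnv.eval_coverIsLarge ⟨h', hP, hP', hD, hD', ?_, ?_, ?_,
      Function.update_self _ _ _, Finset.mem_inter.1 hv⟩
    · rw [Function.update_of_ne (by omega), h1]
    · rw [Function.update_of_ne (by omega), h9]
    · rw [Function.update_of_ne (by omega), h10]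
  have hup : ∀ {ρ : ℕ → ℕ} {x : ℕ} {s : ℕ}, s ≠ 10 → Function.update ρ 10 x s = ρ s :=
    fun hs => Function.update_of_ne hs _ _
  have hex : (countV 10 certificateTerm).eval N mem ρ ≠ 0 ↔ ∃ v, Cert v :=
    eval_countV_ne_zero h.size h.le (by omega) fun v => hcert (h.update (by omega) v)
      (by rw [hup (by omega), h1]) (by rw [hup (by omega), h9]) (Function.update_self _ _ _)
  by_cases hc : ∃ v, Cert v
  · right
    let s := Finset.univ.filter Cert
    have hs : s.Nonempty := by
      obtain ⟨v, hv⟩ := hc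
      exact ⟨v, by simpa [s] using hv⟩
    obtain ⟨hv, hw⟩ : Cert (s.min' hs) := (Finset.mem_filter.1 (s.min'_mem hs)).2
    refine ⟨s.min' hs, hv, ?_, hw⟩
    have hcount : (countV 20 (.not (.countV 10 (.and (.le (.reg 10) (.reg 20))
        certificateTerm)))).eval N mem ρ = (Finset.Iio (s.min' hs)).card := by
      rw [eval_countV (Q := fun u => u < s.min' hs) h.size h.le (by omega)]
      · congr 1
        ext u
        simp
      · intro u
        have h' := h.update (r := 20) (by omega) u
        rw [eval_not, eval_countV_ne_zero (Q := fun v => v ≤ u ∧ Cert v) h'.size h'.le (by omega)]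
        · constructor
          · intro hno
            by_contra hlt
            exact hno ⟨s.min' hs, not_lt.1 hlt, hv, hw⟩
          · rintro hlt ⟨v', hv', hcv'⟩
            exact absurd (s.min'_le v' (by simpa [s] using hcv')) (not_le.2 (hv'.trans_lt hlt))
        · intro v'
          rw [eval_and, eval_le, hcert (v := v') (h'.update (by omega) v')]
          · simp only [eval, Function.update_self, hup (show 20 ≠ 10 by omega), Fin.val_fin_le]
          · rw [hup (by omega), Function.update_of_ne (by omega), h1]
          · rw [hup (by omega), Function.update_of_ne (by omega), h9]
          · exact Function.update_self _ _ _
    rw [outputTerm, eval, if_pos (hex.2 hc), eval, eval, hcount, Fin.card_Iio, Nat.add_comm]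
  · left
    refine ⟨?_, fun ⟨v, hv, hw⟩ => hc ⟨v, hv, hw⟩⟩
    rw [outputTerm, eval, if_neg (fun hne => hc (hex.1 hne)), eval]

end

/-! ### The program -/

section

open RAM RAM.CTerm

/-- The square of the number of vertices in register `2`. -/
def RAM.squareTerm : CTerm := .sumV 10 (.reg 2)

theorem RAM.eval_squareTerm {N n : ℕ} {mem ρ : ℕ → ℕ} (h2 : ρ 2 = n) (hN : n ≤ N) :
    squareTerm.eval N mem ρ = n * n := by
  have := eval_sumV (mem := mem) (t := .reg 2) (r := 10) (f := fun _ => n) h2 hN (by omega)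
    (fun u => by simp [eval, h2])
  simpa [squareTerm] using this

/-- The part of the program that runs after the thresholds have been computed: it computes the
addresses of the tables and evaluates the output term. -/
def RAM.searchProg : Prog :=
  .seq (.set 2 (.mem (.lit 0))) (.seq (squareTerm.compile 21)
    (.seq (.set 3 (.add (.add (.lit 10) (.reg 2)) (.reg 21)))
    (.seq (.set 4 (.add (.reg 3) (.reg 21))) (.seq (.set 5 (.add (.reg 4) (.reg 21)))
    (.seq (.set 6 (.add (.reg 5) (.reg 2))) (.seq (.set 7 (.add (.reg 6) (.reg 2)))
    (.seq (.set 8 (.add (.reg 7) (.add (.mem (.reg 7)) (.lit 1))))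
    (.seq (outputTerm.compile 21) (.set 0 (.reg 21))))))))))

/-- Given the thresholds, the search program runs in polynomial time, and it either outputs a vertex
with a certificate or establishes that there is none. -/
theorem RAM.exists_runs_searchProg : ∃ K e, ∀ {n : ℕ} (I : MulticutInstance n) (i i' : Fin 3)
    (B B' : Finset (Finset (Fin n))) (D D' : Finset (Fin n)) (P P' : List (Fin n)) (m : ℕ)
    (σ : State), P.Nodup → P'.Nodup → (∀ u ∈ D, u ∈ P) → (∀ u ∈ D', u ∈ P') →
    σ.reg 0 = (inputWords I i i' B B' D D' P P').length → σ.reg 1 = m → σ.reg 9 = 2 * m * m →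
    σ.mem = (fun a => (inputWords I i i' B B' D D' P P').getD a 0) →
    Runs searchProg σ (K * (inputWords I i i' B B' D D' P P').length ^ e) fun σ' =>
      (σ'.reg 0 = 0 ∧ ¬ ∃ v ∈ D ∩ D', ∃ w ∈ D ∩ D', CoverIsLarge
        (GapEdge P.idxOf P'.idxOf (MulticutInstance.SameParts B B' D D' w) v) m) ∨
      ∃ v ∈ D ∩ D', σ'.reg 0 = v + 1 ∧ ∃ w ∈ D ∩ D', CoverIsLarge
        (GapEdge P.idxOf P'.idxOf (MulticutInstance.SameParts B B' D D' w) v) m := by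
  obtain ⟨K, e, hK⟩ := cost_le_pow squareTerm
  obtain ⟨K', e', hK'⟩ := cost_le_pow outputTerm
  refine ⟨K + K' + 40, e + e', ?_⟩
  intro n I i i' B B' D D' P P' m σ hP hP' hD hD' h0 h1 h9 hmem
  obtain ⟨N, hN⟩ : ∃ N, N = (inputWords I i i' B B' D D' P P').length := ⟨_, rfl⟩
  have hN1 : 10 + n ≤ N := by
    simp [hN, inputWords, length_setWords]; omega
  have hm0 : σ.mem 0 = n := by simp [hmem, inputWords]
  rw [← hN] at h0 ⊢
  refine Runs.mono (T := 3 + (squareTerm.cost N + (6 + (4 + (4 + (4 + (4 + (7 +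
    (outputTerm.cost N + 2))))))))) ?_ ?_ fun _ h => h
  · refine Runs.seq_set ?_
    refine Runs.seq (runs_compile (N := N) (d := 11) (by omega) (by rfl) (by omega) ?_) ?_
    · simpa [Function.update] using h0
    rintro σ₁ ⟨a1, a2, a3⟩
    simp only at a1 a2 a3
    rw [eval_squareTerm (n := n) (by simp [Expr.eval, hm0]) (by omega)] at a1
    have b0 : σ₁.reg 0 = N := by rw [a2 0 (by omega)]; simpa [Function.update] using h0
    have b1 : σ₁.reg 1 = m := by rw [a2 1 (by omega)]; simpa [Function.update] using h1
    have b2 : σ₁.reg 2 = n := by rw [a2 2 (by omega)]; simpa [Function.update, Expr.eval] using hm0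
    have b9 : σ₁.reg 9 = 2 * m * m := by
      rw [a2 9 (by omega)]; simpa [Function.update] using h9
    have hlay : ∀ ρ : ℕ → ℕ, ρ 2 = n → ρ 3 = 10 + n + n * n → ρ 4 = ρ 3 + n * n →
        ρ 5 = ρ 4 + n * n → ρ 6 = ρ 5 + n → ρ 7 = ρ 6 + n → ρ 8 = ρ 7 + (P.length + 1) →
        Layout N σ₁.mem ρ (fun u v => ∃ b ∈ B, u ∈ b ∧ v ∈ b)
          (fun u v => ∃ b ∈ B', u ∈ b ∧ v ∈ b) D D' P P' := by
      intro ρ h2 h3 h4 h5 h6 h7 h8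
      rw [a3, hmem, hN]
      exact layout_inputWords I i i' B B' D D' P P' h2 h3 h4 h5 h6 h7 h8
    -- the address in register `7` does not depend on register `8`, which is set from it
    have b7 : σ₁.mem (10 + n + n * n + n * n + n * n + n + n) = P.length := by
      let ρ : ℕ → ℕ := fun r => match r with
        | 2 => n
        | 3 => 10 + n + n * n
        | 4 => 10 + n + n * n + n * n
        | 5 => 10 + n + n * n + n * n + n * n
        | 6 => 10 + n + n * n + n * n + n * n + n
        | 7 => 10 + n + n * n + n * n + n * n + n + n
        | _ => 10 + n + n * n + n * n + n * n + n + n + (P.length + 1)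
      exact (hlay ρ rfl rfl rfl rfl rfl rfl rfl).len
    refine Runs.seq_set (Runs.seq_set (Runs.seq_set (Runs.seq_set (Runs.seq_set
      (Runs.seq_set ?_)))))
    refine Runs.seq (runs_compile (N := N) (d := 21) (by omega) outputTerm_wf le_rfl ?_) ?_
    · simpa [Function.update] using b0
    rintro σ₂ ⟨c1, -, -⟩
    refine Runs.set ?_
    simp only [Expr.eval, Function.update_self, c1]
    refine eval_outputTerm (hlay _ ?_ ?_ ?_ ?_ ?_ ?_ ?_)
      hP hP' hD hD' ?_ ?_
    · simpa [Function.update] using b2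
    · simp [Function.update, b2, a1]
    · simp [Function.update, b2, a1]
    · simp [Function.update, b2, a1]
    · simp [Function.update, b2, a1]
    · simp [Function.update, b2, a1]
    · simp [Function.update, b2, a1, b7]
    · simpa [Function.update] using b1
    · simpa [Function.update] using b9
  · have h1 := hK N (by omega)
    have h2 := hK' N (by omega)
    have h3 : N ^ e ≤ N ^ (e + e') := Nat.pow_le_pow_right (by omega) (by omega)
    have h4 : N ^ e' ≤ N ^ (e + e') := Nat.pow_le_pow_right (by omega) (by omega)
    have h5 : 1 ≤ N ^ (e + e') := Nat.one_le_pow _ _ (by omega)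
    have h6 : K * N ^ e ≤ K * N ^ (e + e') := Nat.mul_le_mul_left _ h3
    have h7 : K' * N ^ e' ≤ K' * N ^ (e + e') := Nat.mul_le_mul_left _ h4
    calc _ = squareTerm.cost N + outputTerm.cost N + 34 := by ring
      _ ≤ K * N ^ (e + e') + K' * N ^ (e + e') + 40 * N ^ (e + e') := by omega
      _ = _ := by ring

end

theorem computable_pow_of {a b : ℕ → ℕ} (ha : Computable a) (hb : Computable b) :
    Computable fun k => a k ^ b k := by
  have : Primrec₂ fun x y : ℕ => x ^ y := Primrec₂.unpaired'.1 Nat.Primrec.pow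
  exact this.to_comp.comp ha hb

theorem mainTheorem5 (c : ℕ → ℕ) (q : ℕ → ℕ → ℕ) (hc : Computable c) (hq : Computable₂ q) :
    ∃ (h f : ℕ → ℕ) (e : ℕ) (prog : RAM.Prog), Computable h ∧ Computable f ∧
      ∀ (n : ℕ) (I : MulticutInstance n) (i i' : Fin 3), i ≠ i' →
      ∀ (A A' : Finset (Fin n × Fin n)) (F F' : Finset (List (Fin n)))
        (B : Finpartition (I.flowVertices F)) (B' : Finpartition (I.flowVertices F')),
      I.IsAugmentation c q i A F B → I.IsAugmentation c q i' A' F' B' →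
      ∀ P ∈ F, ∀ P' ∈ F', ∀ D D' : Finset (Fin n),
      D ⊆ P.toFinset \ I.undel → D' ⊆ P'.toFinset \ I.undel →
      ∃ out : ℕ,
        RAM.OutputsWithin prog (inputWords I i i' B.parts B'.parts D D' P P') out
          (f I.k * (inputWords I i i' B.parts B'.parts D D' P P').length ^ e) ∧
        ((out = 0 ∧ gridRank (consistencyMatrix P P' D D') ≤ h I.k) ∨
          ∃ v ∈ D ∩ D', out = v.val + 1 ∧
            ¬ ∃ S : Finset (Fin n), I.IsSolution S ∧ I.IsShadowless S ∧ v ∈ S ∧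
              I.SplitsAt S i P v ∧ I.SplitsAt S i' P' v) := by
  have hm : Computable fun k => q k (k + 7) :=
    hq.comp .id ((Primrec.nat_add.comp .id (.const 7)).to_comp)
  have hmul : ∀ {a b : ℕ → ℕ}, Computable a → Computable b → Computable fun k => a k * b k :=
    fun ha hb => Primrec.nat_mul.to_comp.comp ha hb
  have hadd : ∀ {a b : ℕ → ℕ}, Computable a → Computable b → Computable fun k => a k + b k :=
    fun ha hb => Primrec.nat_add.to_comp.comp ha hb
  have hm2 : Computable fun k => 2 * q k (k + 7) := hmul (.const 2) hm
  have hmm : Computable fun k => 2 * q k (k + 7) * q k (k + 7) := hmul hm2 hm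
  have hside : Computable fun k => MulticutInstance.gridSide (q k (k + 7)) :=
    hadd (hmul (.const 4) (hadd (hadd hm2 hmm) (.const 1))) (.const 4)
  obtain ⟨T, hT, hprog⟩ := RAM.exists_prog_of_computable hmm
  obtain ⟨T', hT', hprog'⟩ := RAM.exists_prog_of_computable hm
  -- both threshold programs read `k` from register `1`; the first result in register `9` survives
  -- the second program, which only writes from register `10` on
  obtain ⟨p, hp⟩ := hprog 1 9 (by omega)
  obtain ⟨p', hp'⟩ := hprog' 1 10 (by omega)
  obtain ⟨K, e, hsearch⟩ := RAM.exists_runs_searchProg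
  refine ⟨fun k => MulticutInstance.gridSide (q k (k + 7)) ^ (c k * c k),
    fun k => T k + T' k + (K + 5), e,
    .seq (.set 1 (.mem (.lit 1))) (.seq p (.seq p' (.seq (.set 1 (.reg 10)) RAM.searchProg))),
    computable_pow_of hside (hmul hc hc), hadd (hadd hT hT') (.const (K + 5)), ?_⟩
  intro n I i i' hii A A' F F' B B' haug haug' P hP P' hP' D D' hD hD'
  obtain ⟨W, hW⟩ : ∃ W, W = inputWords I i i' B.parts B'.parts D D' P P' := ⟨_, rfl⟩
  have hPn : P.Nodup := (haug.maxflow.1.1 P hP).2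
  have hPn' : P'.Nodup := (haug'.maxflow.1.1 P' hP').2
  have hDP : ∀ u ∈ D, u ∈ P := fun u hu => List.mem_toFinset.1 (Finset.mem_sdiff.1 (hD hu)).1
  have hDP' : ∀ u ∈ D', u ∈ P' := fun u hu =>
    List.mem_toFinset.1 (Finset.mem_sdiff.1 (hD' hu)).1
  have hW1 : 1 ≤ W.length := by simp [hW, inputWords]
  have hk : (RAM.initState W).mem 1 = I.k := by simp [hW, RAM.initState, inputWords]
  have hrun : RAM.Runs (.seq (.set 1 (.mem (.lit 1))) (.seq p (.seq p' (.seq (.set 1 (.reg 10))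
      RAM.searchProg)))) (RAM.initState W) (3 + (T I.k + (T' I.k + (2 + K * W.length ^ e))))
      fun σ' =>
      (σ'.reg 0 = 0 ∧ ¬ ∃ v ∈ D ∩ D', ∃ w ∈ D ∩ D', CoverIsLarge
        (GapEdge P.idxOf P'.idxOf (MulticutInstance.SameParts B.parts B'.parts D D' w) v)
        (q I.k (I.k + 7))) ∨
      ∃ v ∈ D ∩ D', σ'.reg 0 = v + 1 ∧ ∃ w ∈ D ∩ D', CoverIsLarge
        (GapEdge P.idxOf P'.idxOf (MulticutInstance.SameParts B.parts B'.parts D D' w) v)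
        (q I.k (I.k + 7)) := by
    refine RAM.Runs.seq_set ?_
    have e1 : Function.update (RAM.initState W).reg 1
        (RAM.Expr.eval (RAM.initState W) (.mem (.lit 1))) 1 =
        I.k := by simpa [RAM.Expr.eval] using hk
    have e0 : Function.update (RAM.initState W).reg 1
        (RAM.Expr.eval (RAM.initState W) (.mem (.lit 1))) 0 =
        W.length := by simp [Function.update, RAM.initState]
    have g := hp ⟨Function.update (RAM.initState W).reg 1
      (RAM.Expr.eval (RAM.initState W) (.mem (.lit 1))), (RAM.initState W).mem⟩
    simp only [e1] at g
    refine g.seq fun σ₁ ⟨a1, a2, a3⟩ => ?_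
    have g' := hp' σ₁
    rw [a2 1 (by omega), e1] at g'
    refine g'.seq fun σ₂ ⟨b1, b2, b3⟩ => RAM.Runs.seq_set ?_
    rw [hW]
    refine hsearch I i i' B.parts B'.parts D D' P P' (q I.k (I.k + 7)) _ hPn hPn' hDP hDP' ?_ ?_
      ?_ ?_
    · rw [← hW, ← e0, ← a2 0 (by omega), ← b2 0 (by omega)]
      simp [Function.update]
    · simpa [RAM.Expr.eval] using b1
    · rw [← a1, ← b2 9 (by omega)]
      simp [Function.update]
    · simp only [b3, a3, ← hW]
      rfl
  obtain ⟨t, σ, hexec, ht, hout⟩ := hrun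
  rw [← hW]
  refine ⟨σ.reg 0, ⟨t, σ, hexec, ht.trans ?_, rfl⟩, ?_⟩
  · have h1 : 1 ≤ W.length ^ e := Nat.one_le_pow _ _ hW1
    have h2 : T I.k ≤ T I.k * W.length ^ e := Nat.le_mul_of_pos_right _ h1
    have h3 : T' I.k ≤ T' I.k * W.length ^ e := Nat.le_mul_of_pos_right _ h1
    calc _ = T I.k + T' I.k + K * W.length ^ e + 5 := by ring
      _ ≤ T I.k * W.length ^ e + T' I.k * W.length ^ e + K * W.length ^ e + 5 * W.length ^ e := by
        omega
      _ = _ := by ring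
  · rcases hout with ⟨h0, hno⟩ | ⟨v, hv, hv', w, hw, hcert⟩
    · refine .inl ⟨h0, ?_⟩
      by_contra hlt
      have hsub : ∀ {F : Finset (List (Fin n))} {P : List (Fin n)} {D : Finset (Fin n)}, P ∈ F →
          D ⊆ P.toFinset \ I.undel → D ⊆ I.flowVertices F := fun hP hD u hu =>
        Finset.mem_sdiff.2 ⟨Finset.mem_biUnion.2 ⟨_, hP, (Finset.mem_sdiff.1 (hD hu)).1⟩,
          (Finset.mem_sdiff.1 (hD hu)).2⟩
      exact hno (MulticutInstance.exists_coverIsLarge_of_lt_gridRank B B' haug.card_parts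
        haug'.card_parts hPn hPn'
        (hsub hP hD) (hsub hP' hD') (not_le.1 hlt))
    · exact .inr ⟨v, hv, hv', MulticutInstance.not_exists_solution_of_coverIsLarge hii haug haug'
        hP hP' hD hD' hw
        hcert⟩
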